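/- **Setting.** Let $d<0$ be a square-free integer such that $F=\mathbb{Q}(\sqrt d)$ has class number $1$, and write $\mathscr{O}=\mathscr{O}_F$. Put $\partial=1/\sqrt d$ if $d\equiv 1 \bmod 4$ and $\partial=1/(2\sqrt d)$ if $d\equiv 2,3\bmod 4$. Let $L$ be a Hermitian lattice over $\mathscr{O}$ of signature $(1,n)$: a lattice in a Hermitian space $V=L\otimes_{\mathscr O}F$ whose form $\langle\ ,\ \rangle$ (linear in the first, conjugate linear in the second argument) takes values in $\partial\mathscr{O}$ on $L$. Let $L^\vee=\{v\in V\mid \langle v,w\rangle\in\partial\mathscr{O}\ \forall w\in L\}$, $A_L=L^\vee/L$, and let $\Gamma=\widetilde{\mathrm U}(L)$ be the group of isometries of $L$ acting trivially on $A_L$. Let $I\subset L$ be a primitive isotropic sublattice of rank $1$ (a cusp). Let $\Gamma(I)_{\mathbb Q}\subset \mathrm U(V)$ be the stabilizer of $I_F=I\otimes F$, and let $U(I)_{\mathbb Q}=\mathrm{Ker}(\Gamma(I)_{\mathbb Q}\to \mathrm{GL}(I^\perp))$, where $I^\perp\subset V$. For a root of unity $\zeta\in F$ put $U_\zeta=U(I)_{\mathbb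 Q}\cap\langle\Gamma,\zeta\,\mathrm{id}\rangle$; in particular $U_1=U(I)_{\mathbb Q}\cap\Gamma$. Let $\omega=(-1+\sqrt{-3})/2$. The cusp $I$ is called * for $d\ne-1,-3$: *irregular with index 2* if $U_1\neq U_{-1}$; * for $d=-1$: *special-irregular with index 2* if $U_1=U_{-1}\ne U_{\sqrt{-1}}$; *irregular with index 4* if $U_1\ne U_{-1}\neq U_{\sqrt{-1}}$; *irregular with index 2* if $U_1\ne U_{-1}$ and it is not irregular with index 4; * for $d=-3$: *special-irregular with index 2* if $\omega\,\mathrm{id}\in\Gamma$ and $U_1=U_\omega\ne U_{-1}$; *irregular with index 6* if $U_1\neq U_{-1}$ and $U_1\ne U_\omega$; *irregular with index 2* if $U_1\neq U_{-1}$ and it is neither special-irregular with index 2 nor irregular with index 6; *irregular* (resp. *special-irregular*) *with index 3* if $U_1=U_{-1}\ne U_\omega$ and $-\mathrm{id}\notin\Gamma$ (resp. $-\mathrm{id}\in\Gamma$). Let $e$ be a generator of $I$, and let $\mathrm{div}(I)\in F$ denote a generator of $\{\langle \ell,e\rangle\mid \ell\in L\}=\mathrm{div}(I)\,\mathscr{O}$;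 it is determined up to $\mathscr{O}^\times$. **Proposition.** A generator $\mathrm{div}(I)$ exists. If $I$ is irregular or special-irregular for $\Gamma=\widetilde{\mathrm U}(L)$, then, up to a unit, $\mathrm{div}(I)$ is one of the values listed below for the field and the index, and $A_L$ is isomorphic as an $\mathscr{O}$-module to one of the modules listed for that value. Here $a,b$ run over the non-negative integers and we write $(x^k)^m$ for $(\mathscr{O}/x^k\mathscr{O})^m$. **$d=-1$, $\eta=1+\sqrt{-1}$, index 2.** The modules are $(\eta)^a\times(\eta^2)^b\times(\eta^c)$ or $(\eta)^a\times(\eta^2)^b\times(\eta^{d_1})\times(\eta^{d_2})$ with * $\mathrm{div}(I)=1$: $c=3,4,5,6$; $(d_1,d_2)=(3,3),(3,4),(3,5)$. * $\mathrm{div}(I)=1+\sqrt{-1}$: $c=4,\dots,8$; $(d_1,d_2)=(1,7),(3,3),(3,4),(3,5),(3,6),(3,7),(4,4),(4,5),(4,6),(5,5)$. * $\mathrm{div}(I)=2$: $c=6,\dots,10$; $(d_1,d_2)=(3,5),(3,6),(3,7),(3,8),(4,4),(4,5),(4,6),(4,7),(4,8),(5,5),(5,6),(5,7),(6,6)$.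 **$d=-1$, special-irregular with index 2 or irregular with index 4.** $\mathrm{div}(I)=1+\sqrt{-1}$: $(\eta)^a\times(\eta^c)$ with $c=5,6,7$, or $(\eta)^a\times(\eta^{d_1})\times(\eta^{d_2})$ with $(d_1,d_2)=(1,6),(2,4),(2,5),(2,6),(3,3),(3,4),(3,5),(4,4)$. **$d=-2$, $\eta=\sqrt{-2}$, index 2.** The modules are $(\eta)^a\times(\eta^2)^b\times(\eta^c)$ or $(\eta)^a\times(\eta^2)^b\times(\eta^{d_1})\times(\eta^{d_2})$ with * $\mathrm{div}(I)=1/\sqrt{-2}$: $c=3,4,5,6$; $(d_1,d_2)=(3,3),(3,4),(3,5)$. * $\mathrm{div}(I)=1$: $c=4,\dots,8$; $(d_1,d_2)=(2,7),(3,3),(3,4),(3,5),(3,6),(3,7),(4,4),(4,5),(4,6),(5,5)$. * $\mathrm{div}(I)=\sqrt{-2}$: $c=6,\dots,10$; $(d_1,d_2)=(3,5),(3,6),(3,7),(3,8),(4,4),(4,5),(4,6),(4,7),(4,8),(5,5),(5,6),(5,7),(6,6)$. * $\mathrm{div}(I)=2$: $c=6,\dots,12$; $(d_1,d_2)=(1,11),(3,7),(3,8),(3,9),(3,10),(3,11),(4,6),(4,7),(4,8),(4,9),(4,10),(5,5),(5,6),(5,7),(5,8),(5,9),(6,6),(6,7),(6,8),(7,7)$.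 **$d=-3$, $\eta=\sqrt{-3}$, (special-)irregular with index 2.** * $\mathrm{div}(I)=1/\sqrt{-3}$: $(2)^a$. * $\mathrm{div}(I)=1$: $(2)^a\times(\eta^2)$ or $(2)^a\times(\eta)^2$. * $\mathrm{div}(I)=2/\sqrt{-3}$: $(2)^a\times(2^c)$ with $c=0,2,3$, or $(2)^a\times(2^2)^2$. * $\mathrm{div}(I)=2$: $(2)^a\times(\eta^2)$, $(2)^a\times(\eta^2)^2$, $(2)^a\times(2^c)\times(\eta^2)$ or $(2)^a\times(2^c)\times(\eta)^2$ with $c=2,3$, $(2)^a\times(2^2)^2\times(\eta^2)$, or $(2)^a\times(2^2)^2\times(\eta)^2$. **$d=-3$, (special-)irregular with index 3.** * $\mathrm{div}(I)=1/\sqrt{-3}$: $(2)^a$. * $\mathrm{div}(I)=1$: $(\eta)^a\times(\eta^2)^b\times(\eta^c)$ with $c=0,3,4$, or $(\eta)^a\times(\eta^2)^b\times(\eta^3)^2$. * $\mathrm{div}(I)=\sqrt{-3}$: $(\eta)^a\times(\eta^2)^b\times(\eta^c)$ with $c=0,3,4,5,6$, $(\eta)^a\times(\eta^2)^b\times(\eta^3)^2$,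 or $(\eta)^a\times(\eta^2)^b\times(\eta^3)\times(\eta^{d'})$ with $d'=4,5$. **$d=-3$, index 6.** $\mathrm{div}(I)=1/\sqrt{-3}$: $A_L=0$. $\mathrm{div}(I)=1$: $(\eta^2)$ or $(\eta)^2$. **$d=-7$, $\eta_1=(1+\sqrt{-7})/2$, $\eta_2=(-1+\sqrt{-7})/2$, $\delta=\sqrt{-7}$, index 2.** For integers $i,j$ and a module $M$ write $[i,j;M]$ for the modules $(\eta_1)^{a+i}\times(\eta_2)^{a+j}\times M$, where $a\ge0$ is such that both exponents are non-negative; products in $M$ are written by juxtaposition. * $\mathrm{div}(I)=1/\sqrt{-7}$: $(\eta_1)^a\times(\eta_2)^b$. * $\mathrm{div}(I)=1$: $(\eta_1)^a\times(\eta_2)^b\times N$ with $N=(\delta^2)$ or $(\delta)^2$. * $\mathrm{div}(I)=\eta_1/\sqrt{-7}$: $[-2,0;(\eta_1^2)^2]$, $[-1,0;(\eta_1^3)]$, $[0,0;(\eta_1^2)]$, $[2,0;0]$. * $\mathrm{div}(I)=\eta_2/\sqrt{-7}$: $[0,-2;(\eta_2^2)^2]$, $[0,-1;(\eta_2^3)]$,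 $[0,0;(\eta_2^2)]$, $[0,2;0]$. * $\mathrm{div}(I)=\eta_1\eta_2/\sqrt{-7}$: $[-2,-2;(\eta_1^2)^2(\eta_2^2)^2]$, $[-2,-1;(\eta_1^2)^2(\eta_2^3)]$, $[-2,0;(\eta_1^2)(\eta_2^2)^2]$, $[-2,0;(\eta_1^2)^2(\eta_2^2)]$, $[-2,1;(\eta_1^2)(\eta_2^3)]$, $[-2,2;(\eta_1^2)(\eta_2^2)]$, $[-1,-2;(\eta_1^3)(\eta_2^2)^2]$, $[-1,-1;(\eta_1^3)(\eta_2^3)]$, $[-1,0;(\eta_1^3)(\eta_2^2)]$, $[0,-2;(\eta_1^2)(\eta_2^2)^2]$, $[0,-2;(\eta_1^2)^2(\eta_2^2)]$, $[0,-1;(\eta_1^2)(\eta_2^3)]$, $[0,0;(\eta_1^2)^2]$, $[0,0;(\eta_2^2)^2]$, $[0,0;(\eta_1^2)(\eta_2^2)]$, $[0,1;(\eta_2^3)]$, $[0,2;(\eta_1^2)]$, $[0,2;(\eta_2^2)]$, $[1,-2;(\eta_1^3)(\eta_2^2)]$, $[1,0;(\eta_1^3)]$, $[2,-2;(\eta_1^2)(\eta_2^2)]$,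 $[2,0;(\eta_1^2)]$, $[2,0;(\eta_2^2)]$, $[2,2;0]$. * $\mathrm{div}(I)=\eta_1$ (resp. $\eta_2$): $X\times N$ with $X$ in the list of $\eta_1/\sqrt{-7}$ (resp. $\eta_2/\sqrt{-7}$) and $N=(\delta^2)$ or $(\delta)^2$. * $\mathrm{div}(I)=\eta_1\eta_2$: $X\times N$ with $N=(\delta^2)$ or $(\delta)^2$ and $X$ one of $[-2,-2;(\eta_1^2)^2(\eta_2^2)^2]$, $[-2,-1;(\eta_1^2)^2(\eta_2^3)]$, $[-2,0;(\eta_1^2)^2(\eta_2^2)]$, $[-2,2;(\eta_1^2)^2]$, $[-1,-2;(\eta_1^3)(\eta_2^2)^2]$, $[-1,-1;(\eta_1^3)(\eta_2^3)]$, $[-1,0;(\eta_1^3)(\eta_2^2)]$, $[-1,2;(\eta_1^3)]$, $[0,-2;(\eta_1^2)(\eta_2^2)^2]$, $[0,-1;(\eta_1^2)(\eta_2^3)]$, $[0,0;(\eta_1^2)(\eta_2^2)]$, $[0,2;(\eta_1^2)]$, $[2,-2;(\eta_2^2)^2]$, $[2,-1;(\eta_2^3)]$, $[2,0;(\eta_2^2)]$,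 $[2,2;0]$. **All other $d$ (that is, $d=-11,-19,-43,-67,-163$), $\eta=\sqrt d$, index 2.** * $\mathrm{div}(I)=1/\sqrt d$: $(2)^a\times(\eta)$. * $\mathrm{div}(I)=2/\sqrt d$: $(2)^a\times(2^c)$ with $c=0,2,3$, $(2)^a\times(2^2)^2$, $(2)^a\times(\eta^2)$, or $(2)^a\times(\eta)^2$. * $\mathrm{div}(I)=1$: $(2)^a\times(\eta^2)$ or $(2)^a\times(\eta)^2$. * $\mathrm{div}(I)=2$: $(2)^a\times(2^c)\times(\eta^2)$ or $(2)^a\times(2^c)\times(\eta)^2$ with $c=2,3$, $(2)^a\times(2^2)^2\times(\eta^2)$, or $(2)^a\times(2^2)^2\times(\eta)^2$. -/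

import Mathlib

open scoped NumberField

noncomputable section

namespace UnitaryCusp

section Lattice

variable {F V : Type*} [Field F] [NumberField F] [AddCommGroup V] [Module F V]
  [Module (𝓞 F) V] [IsScalarTower (𝓞 F) F V] {σ : F ≃ₐ[ℚ] F}

/-- The generator of the inverse different of `F = ℚ(√d)`, where `s = √d`:
it is `1 / √d` if `d ≡ 1 mod 4`, and `1 / (2 √d)` if `d ≡ 2, 3 mod 4`. -/
def invDiff (d : ℤ) (s : F) : F := if d % 4 = 1 then s⁻¹ else (2 * s)⁻¹

/-- `L` is an integral Hermitian lattice of signature `(1, n)` in the Hermitian space `(V, h)`.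
The form `h` is linear in the first and conjugate linear in the second variable. -/
structure IsHermitianLattice (d : ℤ) (s : F) (h : V →ₗ[F] V →ₛₗ[(σ : F →+* F)] F) (n : ℕ)
    (L : Submodule (𝓞 F) V) : Prop where
  /-- `L` is finitely generated and spans `V` over `F` -/
  lattice : Submodule.IsLattice F L
  hermitian : ∀ v w : V, h w v = σ (h v w)
  integral : ∀ v ∈ L, ∀ w ∈ L, ∃ x : 𝓞 F, h v w = invDiff d s * x
  /-- there is an orthogonal basis with one vector of positive norm and `n` of negative norm -/
  signature : ∃ (b : Module.Basis (Fin (n + 1)) F V) (q : Fin (n + 1) → ℚ),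
    (∀ i j, i ≠ j → h (b i) (b j) = 0) ∧ (∀ i, h (b i) (b i) = (q i : F)) ∧
    0 < q 0 ∧ ∀ i, i ≠ 0 → q i < 0

/-- The dual lattice `L^∨`. -/
def dualLattice (d : ℤ) (s : F) (h : V →ₗ[F] V →ₛₗ[(σ : F →+* F)] F)
    (L : Submodule (𝓞 F) V) : Submodule (𝓞 F) V where
  carrier := {v | ∀ w ∈ L, ∃ x : 𝓞 F, h v w = invDiff d s * x}
  zero_mem' := fun w _ => ⟨0, by simp⟩
  add_mem' := by
    intro v v' hv hv' w hw
    obtain ⟨x, hx⟩ := hv w hw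
    obtain ⟨y, hy⟩ := hv' w hw
    exact ⟨x + y, by simp [hx, hy, mul_add]⟩
  smul_mem' := by
    intro c v hv w hw
    obtain ⟨x, hx⟩ := hv w hw
    refine ⟨c * x, ?_⟩
    have hc : c • v = (c : F) • v := by
      rw [← algebraMap_smul F c v]
    rw [hc, map_smul, LinearMap.smul_apply, hx, smul_eq_mul]
    push_cast
    ring

/-- The discriminant group `A_L = L^∨ / L`. -/
abbrev DiscGroup (d : ℤ) (s : F) (h : V →ₗ[F] V →ₛₗ[(σ : F →+* F)] F)
    (L : Submodule (𝓞 F) V) : Type _ :=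
  ↥(dualLattice d s h L) ⧸ L.submoduleOf (dualLattice d s h L)

/-- The unitary group `U(V)` of `(V, h)`. -/
def unitaryGroup (h : V →ₗ[F] V →ₛₗ[(σ : F →+* F)] F) : Subgroup (V ≃ₗ[F] V) where
  carrier := {g | ∀ v w, h (g v) (g w) = h v w}
  one_mem' := fun _ _ => rfl
  mul_mem' := by
    intro g g' hg hg' v w
    exact (hg (g' v) (g' w)).trans (hg' v w)
  inv_mem' := by
    intro g hg v w
    have key := hg (g⁻¹ v) (g⁻¹ w)
    have e : ∀ u, g (g⁻¹ u) = u := fun u => g.apply_symm_apply u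
    rw [e, e] at key
    exact key.symm

/-- The arithmetic group `U(L)(ℤ)` of all isometries that map `L` onto `L`. -/
def latticeGroup (h : V →ₗ[F] V →ₛₗ[(σ : F →+* F)] F) (L : Submodule (𝓞 F) V) :
    Subgroup (V ≃ₗ[F] V) where
  carrier := {g | g ∈ unitaryGroup h ∧ ∀ v, g v ∈ L ↔ v ∈ L}
  one_mem' := ⟨one_mem _, fun _ => Iff.rfl⟩
  mul_mem' := by
    intro g g' hg hg'
    exact ⟨mul_mem hg.1 hg'.1, fun v => (hg.2 (g' v)).trans (hg'.2 v)⟩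
  inv_mem' := by
    intro g hg
    refine ⟨inv_mem hg.1, fun v => ?_⟩
    have key := hg.2 (g⁻¹ v)
    have e : g (g⁻¹ v) = v := g.apply_symm_apply v
    rw [e] at key
    exact key.symm

/-- The discriminant kernel: the isometries of `L` that act trivially on `L^∨ / L`. -/
def discKernel (d : ℤ) (s : F) (h : V →ₗ[F] V →ₛₗ[(σ : F →+* F)] F)
    (L : Submodule (𝓞 F) V) : Subgroup (V ≃ₗ[F] V) where
  carrier := {g | g ∈ latticeGroup h L ∧ ∀ v ∈ dualLattice d s h L, g v - v ∈ L}
  one_mem' := ⟨one_mem _, fun v _ => by simp⟩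
  mul_mem' := by
    intro g g' hg hg'
    refine ⟨mul_mem hg.1 hg'.1, fun v hv => ?_⟩
    have h1 : g (g' v - v) ∈ L := (hg.1.2 _).2 (hg'.2 v hv)
    have h2 := L.add_mem h1 (hg.2 v hv)
    have h3 : (g * g') v - v = g (g' v - v) + (g v - v) := by
      rw [LinearEquiv.mul_apply, map_sub]
      abel
    rw [h3]
    exact h2
  inv_mem' := by
    intro g hg
    refine ⟨inv_mem hg.1, fun v hv => ?_⟩
    have h1 : g⁻¹ (g v - v) ∈ L := ((inv_mem hg.1 : g⁻¹ ∈ latticeGroup h L).2 _).2 (hg.2 v hv)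
    have h2 : g⁻¹ v - v = -(g⁻¹ (g v - v)) := by
      have e : g⁻¹ (g v) = v := g.symm_apply_apply v
      rw [map_sub, e]
      abel
    rw [h2]
    exact L.neg_mem h1

/-- `I` is a primitive isotropic sublattice of rank one of `L` (a cusp). -/
structure IsCusp (h : V →ₗ[F] V →ₛₗ[(σ : F →+* F)] F) (L I : Submodule (𝓞 F) V) : Prop where
  le : I ≤ L
  rank_one : Module.finrank (𝓞 F) I = 1
  primitive : ∀ v ∈ L, ∀ c : 𝓞 F, c ≠ 0 → c • v ∈ I → v ∈ I
  isotropic : ∀ v ∈ I, ∀ w ∈ I, h v w = 0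

/-- `δ` is a value of `div(I)`: a generator of the (fractional) ideal `{⟨ℓ, e⟩ | ℓ ∈ L}`,
where `e` is a generator of `I`. -/
def IsDiv (h : V →ₗ[F] V →ₛₗ[(σ : F →+* F)] F) (L I : Submodule (𝓞 F) V) (δ : F) : Prop :=
  ∃ e : V, I = Submodule.span (𝓞 F) {e} ∧
    ∀ y : F, (∃ l ∈ L, h l e = y) ↔ ∃ x : 𝓞 F, y = x * δ

/-- The stabilizer `Γ(I)_ℚ` in `U(V)` of the line `I ⊗ F`. -/
def cuspStabilizer (h : V →ₗ[F] V →ₛₗ[(σ : F →+* F)] F) (I : Submodule (𝓞 F) V) :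
    Set (V ≃ₗ[F] V) :=
  {g | g ∈ unitaryGroup h ∧ (Submodule.span F (I : Set V)).map (g : V →ₗ[F] V) =
    Submodule.span F (I : Set V)}

/-- The centre `U(I)_ℚ` of the unipotent radical: the kernel of `Γ(I)_ℚ → GL(I^⊥)`,
where `I^⊥` is the orthogonal complement of `I` in `V`. -/
def centreU (h : V →ₗ[F] V →ₛₗ[(σ : F →+* F)] F) (I : Submodule (𝓞 F) V) :
    Set (V ≃ₗ[F] V) :=
  {g | g ∈ cuspStabilizer h I ∧ ∀ v : V, (∀ w ∈ I, h v w = 0) → g v = v}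

/-- The homothety `x · id` belongs to `Γ`. -/
def HasScalar (Γ : Subgroup (V ≃ₗ[F] V)) (x : F) : Prop := ∃ g ∈ Γ, ∀ v, g v = x • v

/-- The group `⟨Γ, x · id⟩`. -/
def withScalar (Γ : Subgroup (V ≃ₗ[F] V)) (x : F) : Subgroup (V ≃ₗ[F] V) :=
  Subgroup.closure ((Γ : Set (V ≃ₗ[F] V)) ∪ {g | ∀ v, g v = x • v})

/-- `U(I)_ℤ = U(I)_ℚ ∩ Γ`. -/
def arithU (h : V →ₗ[F] V →ₛₗ[(σ : F →+* F)] F) (I : Submodule (𝓞 F) V)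
    (Γ : Subgroup (V ≃ₗ[F] V)) : Set (V ≃ₗ[F] V) := centreU h I ∩ Γ

/-- `U(I)_ℤ ≠ U(I)_ℚ ∩ ⟨Γ, -id⟩`. For `F ≠ ℚ(√-1), ℚ(√-3)` this is the definition of
irregularity with index 2. -/
def IsIrregular2 (h : V →ₗ[F] V →ₛₗ[(σ : F →+* F)] F) (I : Submodule (𝓞 F) V)
    (Γ : Subgroup (V ≃ₗ[F] V)) : Prop :=
  arithU h I Γ ≠ arithU h I (withScalar Γ (-1))

namespace Gauss

/-! The case `F = ℚ(√-1)`, with `s = √-1`. -/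

/-- Special-irregular with index 2. -/
def IsSpecial2 (h : V →ₗ[F] V →ₛₗ[(σ : F →+* F)] F) (I : Submodule (𝓞 F) V)
    (Γ : Subgroup (V ≃ₗ[F] V)) (s : F) : Prop :=
  arithU h I Γ = arithU h I (withScalar Γ (-1)) ∧
    arithU h I (withScalar Γ (-1)) ≠ arithU h I (withScalar Γ s)

/-- Irregular with index 4. -/
def IsIrregular4 (h : V →ₗ[F] V →ₛₗ[(σ : F →+* F)] F) (I : Submodule (𝓞 F) V)
    (Γ : Subgroup (V ≃ₗ[F] V)) (s : F) : Prop :=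
  arithU h I Γ ≠ arithU h I (withScalar Γ (-1)) ∧
    arithU h I (withScalar Γ (-1)) ≠ arithU h I (withScalar Γ s)

/-- Irregular with index 2. -/
def IsIrregular2 (h : V →ₗ[F] V →ₛₗ[(σ : F →+* F)] F) (I : Submodule (𝓞 F) V)
    (Γ : Subgroup (V ≃ₗ[F] V)) (s : F) : Prop :=
  UnitaryCusp.IsIrregular2 h I Γ ∧ ¬ IsIrregular4 h I Γ s

end Gauss

namespace Eisenstein

/-! The case `F = ℚ(√-3)`, with `s = √-3`. -/

/-- The primitive cube root of unity `ω`. -/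
def omega (s : F) : F := (-1 + s) / 2

/-- Special-irregular with index 2. -/
def IsSpecial2 (h : V →ₗ[F] V →ₛₗ[(σ : F →+* F)] F) (I : Submodule (𝓞 F) V)
    (Γ : Subgroup (V ≃ₗ[F] V)) (s : F) : Prop :=
  HasScalar Γ (omega s) ∧
    arithU h I Γ = arithU h I (withScalar Γ (omega s)) ∧
    arithU h I Γ ≠ arithU h I (withScalar Γ (-1))

/-- Special-irregular with index 3. -/
def IsSpecial3 (h : V →ₗ[F] V →ₛₗ[(σ : F →+* F)] F) (I : Submodule (𝓞 F) V)
    (Γ : Subgroup (V ≃ₗ[F] V)) (s : F) : Prop :=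
  HasScalar Γ (-1) ∧
    arithU h I Γ = arithU h I (withScalar Γ (-1)) ∧
    arithU h I Γ ≠ arithU h I (withScalar Γ (omega s))

/-- Irregular with index 3. -/
def IsIrregular3 (h : V →ₗ[F] V →ₛₗ[(σ : F →+* F)] F) (I : Submodule (𝓞 F) V)
    (Γ : Subgroup (V ≃ₗ[F] V)) (s : F) : Prop :=
  ¬ HasScalar Γ (-1) ∧
    arithU h I Γ = arithU h I (withScalar Γ (-1)) ∧
    arithU h I Γ ≠ arithU h I (withScalar Γ (omega s))

/-- Irregular with index 6. -/
def IsIrregular6 (h : V →ₗ[F] V →ₛₗ[(σ : F →+* F)] F) (I : Submodule (𝓞 F) V)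
    (Γ : Subgroup (V ≃ₗ[F] V)) (s : F) : Prop :=
  arithU h I Γ ≠ arithU h I (withScalar Γ (-1)) ∧
    arithU h I Γ ≠ arithU h I (withScalar Γ (omega s))

/-- Irregular with index 2. -/
def IsIrregular2 (h : V →ₗ[F] V →ₛₗ[(σ : F →+* F)] F) (I : Submodule (𝓞 F) V)
    (Γ : Subgroup (V ≃ₗ[F] V)) (s : F) : Prop :=
  UnitaryCusp.IsIrregular2 h I Γ ∧ ¬ IsSpecial2 h I Γ s ∧ ¬ IsIrregular6 h I Γ s

end Eisenstein

end Lattice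

section Modules

variable {F : Type*} [Field F] [NumberField F]

/-- The ideal `x 𝓞_F` of `𝓞_F` for an integral element `x` of `F`. -/
def principal (x : F) : Ideal (𝓞 F) :=
  (Submodule.span (𝓞 F) {x}).comap (Algebra.linearMap (𝓞 F) F)

/-- A shape is a list of triples; a triple `(x, k, m)` stands for `(𝓞_F / x ^ k) ^ m`,
and the list for the direct product. -/
abbrev Shape (F : Type*) := List (F × ℕ × ℕ)

/-- The `𝓞_F`-module described by a shape. -/
abbrev Shape.Mod (l : Shape F) : Type _ :=
  (i : Fin l.length) → Fin (l.get i).2.2 → 𝓞 F ⧸ principal ((l.get i).1 ^ (l.get i).2.1)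

/-- A row of a table: a value of `div(I)`, and the shapes that belong to it. -/
abbrev Row (F : Type*) := F × Set (Shape F)

/-- `div(I) = δ` is, up to a unit, one of the values in the table, and the module `A` is isomorphic
to one of the modules in the corresponding row. -/
def InTable (T : List (Row F)) (δ : F) (A : Type*) [AddCommGroup A] [Module (𝓞 F) A] : Prop :=
  ∃ r ∈ T, (∃ u : (𝓞 F)ˣ, δ = ((u : 𝓞 F) : F) * r.1) ∧
    ∃ l ∈ r.2, Nonempty (A ≃ₗ[𝓞 F] Shape.Mod l)

/-- All `(𝓞 / η) ^ a × (𝓞 / η²) ^ b × M` with `M` in the list `R` and `a, b ≥ 0`. -/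
def family2 (η : F) (R : List (Shape F)) : Set (Shape F) :=
  {l | ∃ a b : ℕ, ∃ r ∈ R, l = (η, 1, a) :: (η, 2, b) :: r}

/-- All `(𝓞 / x) ^ a × M` with `M` in the list `R` and `a ≥ 0`. -/
def family1 (x : F) (R : List (Shape F)) : Set (Shape F) :=
  {l | ∃ a : ℕ, ∃ r ∈ R, l = (x, 1, a) :: r}

/-- The modules `𝓞 / η ^ c`. -/
def singles (η : F) (cs : List ℕ) : List (Shape F) := cs.map fun c => [(η, c, 1)]

/-- The modules `𝓞 / η ^ d₁ × 𝓞 / η ^ d₂`. -/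
def pairs (η : F) (ds : List (ℕ × ℕ)) : List (Shape F) :=
  ds.map fun p => [(η, p.1, 1), (η, p.2, 1)]

/-- All `(𝓞 / η₁) ^ (a + i) × (𝓞 / η₂) ^ (a + j) × M` with `(i, j, M)` in the list `R`,
where `a ≥ 0` and both exponents are non-negative. -/
def family7 (η₁ η₂ : F) (R : List (ℤ × ℤ × Shape F)) : Set (Shape F) :=
  {l | ∃ a m₁ m₂ : ℕ, ∃ r ∈ R, (m₁ : ℤ) = a + r.1 ∧ (m₂ : ℤ) = a + r.2.1 ∧
    l = (η₁, 1, m₁) :: (η₂, 1, m₂) :: r.2.2}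

/-- All products of a module in `S` with `𝓞 / δ²` or with `(𝓞 / δ)²`. -/
def timesDelta (δ : F) (S : Set (Shape F)) : Set (Shape F) :=
  {l | ∃ l' ∈ S, l = l' ++ [(δ, 2, 1)] ∨ l = l' ++ [(δ, 1, 2)]}

/-! ### `F = ℚ(√-1)`, `s = √-1`, `η = 1 + √-1` -/

/-- Irregular with index 2. -/
def tableGauss2 (s : F) : List (Row F) :=
  let η : F := 1 + s
  [(1, family2 η (singles η [3, 4, 5, 6] ++ pairs η [(3, 3), (3, 4), (3, 5)])),
   (1 + s, family2 η (singles η [4, 5, 6, 7, 8] ++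
      pairs η [(1, 7), (3, 3), (3, 4), (3, 5), (3, 6), (3, 7), (4, 4), (4, 5), (4, 6), (5, 5)])),
   (2, family2 η (singles η [6, 7, 8, 9, 10] ++
      pairs η [(3, 5), (3, 6), (3, 7), (3, 8), (4, 4), (4, 5), (4, 6), (4, 7), (4, 8), (5, 5),
        (5, 6), (5, 7), (6, 6)]))]

/-- Special-irregular with index 2, or irregular with index 4. -/
def tableGauss4 (s : F) : List (Row F) :=
  let η : F := 1 + s
  [(1 + s, family1 η (singles η [5, 6, 7] ++
      pairs η [(1, 6), (2, 4), (2, 5), (2, 6), (3, 3), (3, 4), (3, 5), (4, 4)]))]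

/-! ### `F = ℚ(√-2)`, `s = η = √-2` -/

/-- Irregular with index 2. -/
def tableTwo (s : F) : List (Row F) :=
  [(1 / s, family2 s (singles s [3, 4, 5, 6] ++ pairs s [(3, 3), (3, 4), (3, 5)])),
   (1, family2 s (singles s [4, 5, 6, 7, 8] ++
      pairs s [(2, 7), (3, 3), (3, 4), (3, 5), (3, 6), (3, 7), (4, 4), (4, 5), (4, 6), (5, 5)])),
   (s, family2 s (singles s [6, 7, 8, 9, 10] ++
      pairs s [(3, 5), (3, 6), (3, 7), (3, 8), (4, 4), (4, 5), (4, 6), (4, 7), (4, 8), (5, 5),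
        (5, 6), (5, 7), (6, 6)])),
   (2, family2 s (singles s [6, 7, 8, 9, 10, 11, 12] ++
      pairs s [(1, 11), (3, 7), (3, 8), (3, 9), (3, 10), (3, 11), (4, 6), (4, 7), (4, 8), (4, 9),
        (4, 10), (5, 5), (5, 6), (5, 7), (5, 8), (5, 9), (6, 6), (6, 7), (6, 8), (7, 7)]))]

/-! ### `F = ℚ(√-3)`, `s = η = √-3` -/

/-- (Special-)irregular with index 2. -/
def tableEisenstein2 (s : F) : List (Row F) :=
  [(1 / s, family1 2 [[]]),
   (1, family1 2 [[(s, 2, 1)], [(s, 1, 2)]]),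
   (2 / s, family1 2 [[(2, 0, 1)], [(2, 2, 1)], [(2, 3, 1)], [(2, 2, 2)]]),
   (2, family1 2 [[(s, 2, 1)], [(s, 2, 2)],
      [(2, 2, 1), (s, 2, 1)], [(2, 3, 1), (s, 2, 1)],
      [(2, 2, 1), (s, 1, 2)], [(2, 3, 1), (s, 1, 2)],
      [(2, 2, 2), (s, 2, 1)], [(2, 2, 2), (s, 1, 2)]])]

/-- (Special-)irregular with index 3. -/
def tableEisenstein3 (s : F) : List (Row F) :=
  [(1 / s, family1 2 [[]]),
   (1, family2 s (singles s [0, 3, 4] ++ [[(s, 3, 2)]])),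
   (s, family2 s (singles s [0, 3, 4, 5, 6] ++ [[(s, 3, 2)]] ++ pairs s [(3, 4), (3, 5)]))]

/-- Irregular with index 6. -/
def tableEisenstein6 (s : F) : List (Row F) :=
  [(1 / s, {[]}),
   (1, {[(s, 2, 1)], [(s, 1, 2)]})]

/-! ### `F = ℚ(√-7)`, `s = δ = √-7`, `η₁ = (1 + √-7) / 2`, `η₂ = (-1 + √-7) / 2` -/

/-- Irregular with index 2. -/
def tableSeven (s : F) : List (Row F) :=
  let η₁ : F := (1 + s) / 2
  let η₂ : F := (-1 + s) / 2
  let A₀ : Set (Shape F) := {l | ∃ a b : ℕ, l = [(η₁, 1, a), (η₂, 1, b)]}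
  let A₁ : Set (Shape F) := family7 η₁ η₂
    [(-2, 0, [(η₁, 2, 2)]), (-1, 0, [(η₁, 3, 1)]), (0, 0, [(η₁, 2, 1)]), (2, 0, [])]
  let A₂ : Set (Shape F) := family7 η₁ η₂
    [(0, -2, [(η₂, 2, 2)]), (0, -1, [(η₂, 3, 1)]), (0, 0, [(η₂, 2, 1)]), (0, 2, [])]
  let A₃ : Set (Shape F) := family7 η₁ η₂
    [(-2, -2, [(η₁, 2, 2), (η₂, 2, 2)]),
     (-2, -1, [(η₁, 2, 2), (η₂, 3, 1)]),
     (-2, 0, [(η₁, 2, 1), (η₂, 2, 2)]),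
     (-2, 0, [(η₁, 2, 2), (η₂, 2, 1)]),
     (-2, 1, [(η₁, 2, 1), (η₂, 3, 1)]),
     (-2, 2, [(η₁, 2, 1), (η₂, 2, 1)]),
     (-1, -2, [(η₁, 3, 1), (η₂, 2, 2)]),
     (-1, -1, [(η₁, 3, 1), (η₂, 3, 1)]),
     (-1, 0, [(η₁, 3, 1), (η₂, 2, 1)]),
     (0, -2, [(η₁, 2, 1), (η₂, 2, 2)]),
     (0, -2, [(η₁, 2, 2), (η₂, 2, 1)]),
     (0, -1, [(η₁, 2, 1), (η₂, 3, 1)]),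
     (0, 0, [(η₁, 2, 2)]),
     (0, 0, [(η₂, 2, 2)]),
     (0, 0, [(η₁, 2, 1), (η₂, 2, 1)]),
     (0, 1, [(η₂, 3, 1)]),
     (0, 2, [(η₁, 2, 1)]),
     (0, 2, [(η₂, 2, 1)]),
     (1, -2, [(η₁, 3, 1), (η₂, 2, 1)]),
     (1, 0, [(η₁, 3, 1)]),
     (2, -2, [(η₁, 2, 1), (η₂, 2, 1)]),
     (2, 0, [(η₁, 2, 1)]),
     (2, 0, [(η₂, 2, 1)]),
     (2, 2, [])]
  let A₄ : Set (Shape F) := family7 η₁ η₂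
    [(-2, -2, [(η₁, 2, 2), (η₂, 2, 2)]),
     (-2, -1, [(η₁, 2, 2), (η₂, 3, 1)]),
     (-2, 0, [(η₁, 2, 2), (η₂, 2, 1)]),
     (-2, 2, [(η₁, 2, 2)]),
     (-1, -2, [(η₁, 3, 1), (η₂, 2, 2)]),
     (-1, -1, [(η₁, 3, 1), (η₂, 3, 1)]),
     (-1, 0, [(η₁, 3, 1), (η₂, 2, 1)]),
     (-1, 2, [(η₁, 3, 1)]),
     (0, -2, [(η₁, 2, 1), (η₂, 2, 2)]),
     (0, -1, [(η₁, 2, 1), (η₂, 3, 1)]),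
     (0, 0, [(η₁, 2, 1), (η₂, 2, 1)]),
     (0, 2, [(η₁, 2, 1)]),
     (2, -2, [(η₂, 2, 2)]),
     (2, -1, [(η₂, 3, 1)]),
     (2, 0, [(η₂, 2, 1)]),
     (2, 2, [])]
  [(1 / s, A₀),
   (1, timesDelta s A₀),
   (η₁ / s, A₁),
   (η₂ / s, A₂),
   (η₁ * η₂ / s, A₃),
   (η₁, timesDelta s A₁),
   (η₂, timesDelta s A₂),
   (η₁ * η₂, timesDelta s A₄)]

/-! ### The other fields, `s = η = √d` -/

/-- Irregular with index 2. -/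
def tableOther (s : F) : List (Row F) :=
  [(1 / s, family1 2 [[(s, 1, 1)]]),
   (2 / s, family1 2 [[(2, 0, 1)], [(2, 2, 1)], [(2, 3, 1)], [(2, 2, 2)], [(s, 2, 1)],
      [(s, 1, 2)]]),
   (1, family1 2 [[(s, 2, 1)], [(s, 1, 2)]]),
   (2, family1 2 [[(2, 2, 1), (s, 2, 1)], [(2, 3, 1), (s, 2, 1)],
      [(2, 2, 1), (s, 1, 2)], [(2, 3, 1), (s, 1, 2)],
      [(2, 2, 2), (s, 2, 1)], [(2, 2, 2), (s, 1, 2)]])]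

end Modules

end UnitaryCusp

end

set_option linter.unusedSectionVars false

namespace UnitaryCusp

/-! ### Integers, conjugation and the prime 2 in an imaginary quadratic field. -/

section QuadraticField

variable {F : Type*} [Field F] [NumberField F]

/-! Write ∂ for the generator of the inverse different and Γ for the discriminant kernel. An element
of U(I)_ℚ is a transvection v ↦ v + t⟨v, e⟩e for which τ = t∂ is rational, and it lies in Γ as soon
as τ is an integer. Suppose it equals c·γ with γ ∈ Γ and c a root of unity, and write div(I) = ∂m.
Since γ acts trivially on A_L, (1 - c)v + τ(⟨v, e⟩/∂)e lies in L for every v ∈ L^∨. A vector of L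
with ⟨v, e⟩ = ∂m gives τm ∈ 𝓞, and v = e/σ(m) gives m ∣ σ(1 - c)
(`IsHermitianLattice.transvection_constraints`).

If c is a primitive fourth or cube root of unity, σ(1 - c) has norm 2 or 3 and these two conditions
force τ ∈ ℤ. Hence U₋₁ = U_i for d = -1 and U₁ = U_ω for d = -3: the special-irregular case with
index 2 for d = -1 and the cases with index 3, 4 and 6 never occur for Γ, and their tables hold
vacuously.

If c = -1 and τ ∉ ℤ, then τ ∈ 1/2 + ℤ and m is 2 up to a unit, so div(I) = 2∂. As e is primitive,
some w ∈ L^∨ represents ∂f with f(e) = 1 and f integral on L. The relation at v = w says that 4f(w)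
is 1 plus twice an integer. So w spans a direct summand 𝓞/4 of A_L, and the complement C is killed
by 2 (`IsHermitianLattice.exists_splitting`).

It remains to decompose C × 𝓞/4 according to whether 2 is ramified (d = -1, -2), split (d = -7) or
inert. In the split case the discriminant form, which interchanges the two primes above 2, makes
their exponents in C equal (`IsHermitianLattice.exponent_le`). A single row of each index 2 table is
therefore enough. -/

/-- Membership of an element of `F` in the ring of integers. -/
def IsInt (x : F) : Prop := ∃ r : 𝓞 F, (r : F) = x

theorem isInt_iff {x : F} : IsInt x ↔ IsIntegral ℤ x :=
  ⟨fun ⟨r, hr⟩ => hr ▸ r.isIntegral_coe, fun hx => ⟨⟨x, hx⟩, rfl⟩⟩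

theorem IsInt.add {x y : F} (hx : IsInt x) (hy : IsInt y) : IsInt (x + y) :=
  isInt_iff.2 ((isInt_iff.1 hx).add (isInt_iff.1 hy))

theorem IsInt.sub {x y : F} (hx : IsInt x) (hy : IsInt y) : IsInt (x - y) :=
  isInt_iff.2 ((isInt_iff.1 hx).sub (isInt_iff.1 hy))

theorem IsInt.mul {x y : F} (hx : IsInt x) (hy : IsInt y) : IsInt (x * y) :=
  isInt_iff.2 ((isInt_iff.1 hx).mul (isInt_iff.1 hy))

theorem IsInt.neg {x : F} (hx : IsInt x) : IsInt (-x) := isInt_iff.2 (isInt_iff.1 hx).neg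

theorem isInt_coe (r : 𝓞 F) : IsInt (r : F) := ⟨r, rfl⟩

theorem isInt_intCast (k : ℤ) : IsInt (k : F) := ⟨k, by simp⟩

theorem IsInt.map (σ : F ≃ₐ[ℚ] F) {x : F} (hx : IsInt x) : IsInt (σ x) :=
  isInt_iff.2 ((isInt_iff.1 hx).map (σ.toAlgHom.restrictScalars ℤ))

/-- A rational number that is integral in `F` is an integer. -/
theorem exists_int_of_isInt_ratCast {q : ℚ} (hq : IsInt (q : F)) : ∃ k : ℤ, q = k := by
  have h1 : IsIntegral ℤ (algebraMap ℚ F q) := by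
    simpa using isInt_iff.1 hq
  rw [isIntegral_algebraMap_iff (algebraMap ℚ F).injective] at h1
  obtain ⟨k, hk⟩ := IsIntegrallyClosed.isIntegral_iff.1 h1
  exact ⟨k, by simpa using hk.symm⟩

variable {d : ℤ} {s : F} {σ : F ≃ₐ[ℚ] F}

theorem sqrt_ne_zero (hd : d < 0) (hs : s ^ 2 = (d : F)) : s ≠ 0 := by
  rintro rfl
  have : (d : F) = 0 := by rw [← hs]; simp
  exact hd.ne (by exact_mod_cast this)

theorem exists_coords (hd : d < 0) (hF : Module.finrank ℚ F = 2) (hs : s ^ 2 = (d : F))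
    (hσ : σ s = -s) (x : F) : ∃ a b : ℚ, x = a + b * s := by
  have hs0 := sqrt_ne_zero hd hs
  have hli : LinearIndependent ℚ ![(1 : F), s] := by
    rw [LinearIndependent.pair_iff]
    intro a b hab
    simp only [Rat.smul_def, mul_one] at hab
    have h2 := congrArg σ hab
    simp only [map_add, map_mul, map_ratCast, hσ, map_zero] at h2
    have ha : (a : F) = 0 := by linear_combination (hab + h2) / 2
    have hb : (b : F) * s = 0 := by linear_combination (hab - h2) / 2
    exact ⟨by exact_mod_cast ha, by exact_mod_cast (mul_eq_zero.1 hb).resolve_right hs0⟩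
  have hsp := hli.span_eq_top_of_card_eq_finrank' (by simp [hF])
  have hx : x ∈ Submodule.span ℚ (Set.range ![(1 : F), s]) := by rw [hsp]; trivial
  rw [Matrix.range_cons, Matrix.range_cons, Matrix.range_empty, Set.union_empty,
    Set.singleton_union, Submodule.mem_span_pair] at hx
  obtain ⟨a, b, rfl⟩ := hx
  exact ⟨a, b, by simp [Rat.smul_def]⟩

theorem conj_conj (hd : d < 0) (hF : Module.finrank ℚ F = 2) (hs : s ^ 2 = (d : F))
    (hσ : σ s = -s) (x : F) : σ (σ x) = x := by
  obtain ⟨a, b, rfl⟩ := exists_coords hd hF hs hσ x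
  simp [hσ]

theorem exists_ratCast_of_conj_eq (hd : d < 0) (hF : Module.finrank ℚ F = 2)
    (hs : s ^ 2 = (d : F)) (hσ : σ s = -s) {x : F} (hx : σ x = x) : ∃ a : ℚ, x = a := by
  obtain ⟨a, b, rfl⟩ := exists_coords hd hF hs hσ x
  refine ⟨a, ?_⟩
  simp only [map_add, map_mul, map_ratCast, hσ] at hx
  linear_combination -hx / 2

theorem invDiff_ne_zero (hd : d < 0) (hs : s ^ 2 = (d : F)) : invDiff d s ≠ 0 := by
  have hs0 := sqrt_ne_zero hd hs
  unfold invDiff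
  split_ifs <;> simp [hs0]

theorem conj_invDiff (d : ℤ) (hσ : σ s = -s) : σ (invDiff d s) = -invDiff d s := by
  unfold invDiff
  split_ifs
  · rw [map_inv₀, hσ, inv_neg]
  · rw [map_inv₀, map_mul, hσ, map_ofNat, mul_neg, inv_neg]

/-- There are no integers of norm `2` unless `d` is `-1`, `-2` or `-7`. -/
theorem norm_ne_two (hd : d < 0) (hsq : Squarefree d) (hF : Module.finrank ℚ F = 2)
    (hs : s ^ 2 = (d : F)) (hσ : σ s = -s) (h1 : d ≠ -1) (h2 : d ≠ -2) (h7 : d ≠ -7)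
    {x : F} (hx : IsInt x) : x * σ x ≠ 2 := by
  intro hn
  obtain ⟨a, b, rfl⟩ := exists_coords hd hF hs hσ x
  have hn' : a ^ 2 - d * b ^ 2 = 2 := by
    have : ((a ^ 2 - d * b ^ 2 : ℚ) : F) = (2 : ℚ) := by
      push_cast
      rw [← hs, ← hn]
      simp [hσ]
      ring
    exact_mod_cast this
  obtain ⟨A, hA⟩ : ∃ A : ℤ, 2 * a = A := by
    apply exists_int_of_isInt_ratCast (F := F)
    convert hx.add (hx.map σ) using 1
    simp [hσ]
    ring
  have hB : ∃ B : ℤ, 2 * b = B := by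
    have e1 : (d : ℚ) * (2 * b) ^ 2 = (A ^ 2 - 8 : ℤ) := by
      push_cast
      rw [← hA]
      linear_combination -4 * hn'
    generalize 2 * b = y at e1
    -- the denominator of `y` squared divides `d`
    have e2 : d * y.num ^ 2 = (A ^ 2 - 8) * (y.den : ℤ) ^ 2 := by
      have hden : (y.den : ℚ) ≠ 0 := by exact_mod_cast y.den_ne_zero
      have : (d : ℚ) * y.num ^ 2 = (A ^ 2 - 8 : ℤ) * (y.den : ℚ) ^ 2 := by
        have hy : (y.num : ℚ) = y * y.den := (Rat.mul_den_eq_num y).symm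
        rw [← e1, hy]
        ring
      exact_mod_cast this
    have hcop : IsCoprime ((y.den : ℤ) ^ 2) (y.num ^ 2) := by
      apply IsCoprime.pow
      rw [Int.isCoprime_iff_gcd_eq_one, Int.gcd_comm]
      simpa [Int.gcd] using y.reduced
    have hdvd : (y.den : ℤ) * y.den ∣ d := by
      rw [← sq]
      exact hcop.dvd_of_dvd_mul_right (Dvd.intro_left _ e2.symm)
    have hu := hsq _ hdvd
    have hden1 : y.den = 1 := by
      have := Int.isUnit_iff.1 hu
      omega
    exact ⟨y.num, by rw [← Rat.num_div_den y, hden1]; simp⟩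
  obtain ⟨B, hB⟩ := hB
  have key : A ^ 2 - d * B ^ 2 = 8 := by
    have : ((A ^ 2 - d * B ^ 2 : ℤ) : ℚ) = (8 : ℤ) := by
      push_cast
      rw [← hA, ← hB]
      linear_combination 4 * hn'
    exact_mod_cast this
  have hsq4 : ¬ (2 * 2 ∣ d) := fun h => by
    have := Int.isUnit_iff.1 (hsq 2 h)
    omega
  -- Since d < 0, the equation A² - dB² = 8 leaves finitely many pairs; those giving a square-free d
  -- give only -1, -2 and -7.
  have hB2 : |B| ≤ 2 := by
    by_contra! hlt
    have : 9 ≤ B ^ 2 := by rw [← sq_abs]; nlinarith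
    nlinarith [sq_nonneg A]
  have hA2 : |A| ≤ 2 := by
    by_contra! hlt
    have : 9 ≤ A ^ 2 := by rw [← sq_abs]; nlinarith
    nlinarith [sq_nonneg B]
  rw [abs_le] at hA2 hB2
  obtain ⟨a1, a2⟩ := hA2
  obtain ⟨b1, b2⟩ := hB2
  interval_cases A <;> interval_cases B <;> omega

/-- If `2` is prime in the ring of integers, then `d ≡ 1 mod 4`. -/
theorem emod_four_of_prime_two (hsq : Squarefree d) (hs : s ^ 2 = (d : F)) (hσ : σ s = -s)
    (hp : Prime (2 : 𝓞 F)) : d % 4 = 1 := by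
  have hsq4 : ¬ (2 * 2 ∣ d) := fun h => by
    have := Int.isUnit_iff.1 (hsq 2 h)
    omega
  have hsI : IsInt s := by
    refine isInt_iff.2 (IsIntegral.of_pow (n := 2) two_pos ?_)
    rw [hs]
    exact isInt_iff.1 (isInt_intCast d)
  obtain ⟨t, ht⟩ := hsI
  have htt : t ^ 2 = (d : 𝓞 F) := by
    apply FaithfulSMul.algebraMap_injective (𝓞 F) F
    rw [map_pow, map_intCast, ← hs, ← ht]
  by_contra hne
  have aux : ∀ y : 𝓞 F, ∀ k : ℤ, (y : F) * σ y = (k / 4 : ℚ) → 4 ∣ k := by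
    intro y k hy
    obtain ⟨j, hj⟩ := exists_int_of_isInt_ratCast (F := F) (q := (k / 4 : ℚ))
      (hy ▸ (isInt_coe y).mul ((isInt_coe y).map σ))
    refine ⟨j, ?_⟩
    have : (k : ℚ) = (4 * j : ℤ) := by push_cast; rw [← hj]; ring
    exact_mod_cast this
  rcases (by omega : d % 2 = 0 ∨ d % 4 = 3) with h2 | h3
  · obtain ⟨k, hk⟩ : (2 : ℤ) ∣ d := by omega
    have : (2 : 𝓞 F) ∣ t := by
      apply hp.dvd_of_dvd_pow (n := 2)
      rw [htt, hk]
      exact ⟨k, by push_cast; ring⟩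
    obtain ⟨y, rfl⟩ := this
    have h4 := aux y (-d) (by
      have e : s = 2 * (y : F) := by
        rw [← ht]
        exact (map_mul (algebraMap (𝓞 F) F) 2 y).trans (by rw [map_ofNat])
      have e' : (y : F) = s / 2 := by rw [e]; ring
      rw [e', map_div₀, hσ, map_ofNat]
      push_cast
      rw [← hs]
      ring)
    omega
  · obtain ⟨k, hk⟩ : (2 : ℤ) ∣ 1 + d := by omega
    have : (2 : 𝓞 F) ∣ 1 + t := by
      apply hp.dvd_of_dvd_pow (n := 2)
      refine ⟨k + t, ?_⟩
      have hk' : (1 : 𝓞 F) + (d : 𝓞 F) = 2 * k := by exact_mod_cast hk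
      linear_combination htt + hk'
    obtain ⟨y, hy⟩ := this
    have h4 := aux y (1 - d) (by
      have e : 1 + s = 2 * (y : F) := by
        rw [← ht]
        simpa only [map_add, map_mul, map_one, map_ofNat] using congrArg (algebraMap (𝓞 F) F) hy
      have e' : (y : F) = (1 + s) / 2 := by rw [e]; ring
      rw [e', map_div₀, map_add, hσ, map_one, map_ofNat]
      push_cast
      rw [← hs]
      ring)
    omega

end QuadraticField

/-! ### Nondegeneracy, duality and primitive vectors in Hermitian lattices. -/

section HermitianLattice

variable {F V : Type*} [Field F] [NumberField F] [AddCommGroup V] [Module F V]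
  {σ : F ≃ₐ[ℚ] F}

theorem form_smul_left (h : V →ₗ[F] V →ₛₗ[(σ : F →+* F)] F) (c : F) (v w : V) :
    h (c • v) w = c * h v w := by
  rw [map_smul, LinearMap.smul_apply, smul_eq_mul]

theorem form_smul_right (h : V →ₗ[F] V →ₛₗ[(σ : F →+* F)] F) (c : F) (v w : V) :
    h v (c • w) = σ c * h v w := by
  rw [map_smulₛₗ]
  rfl

theorem form_add_left (h : V →ₗ[F] V →ₛₗ[(σ : F →+* F)] F) (u v w : V) :
    h (u + v) w = h u w + h v w := by
  rw [map_add, LinearMap.add_apply]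

theorem form_sub_left (h : V →ₗ[F] V →ₛₗ[(σ : F →+* F)] F) (u v w : V) :
    h (u - v) w = h u w - h v w := by
  rw [map_sub, LinearMap.sub_apply]

variable [Module (𝓞 F) V] [IsScalarTower (𝓞 F) F V]
  {d : ℤ} {s : F} {h : V →ₗ[F] V →ₛₗ[(σ : F →+* F)] F} {n : ℕ} {L I : Submodule (𝓞 F) V}

theorem coe_smul_eq (c : 𝓞 F) (v : V) : (c : F) • v = c • v := algebraMap_smul F c v

theorem IsInt.smul_mem {c : F} (hc : IsInt c) {v : V} (hv : v ∈ L) : c • v ∈ L := by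
  obtain ⟨r, rfl⟩ := hc
  rw [coe_smul_eq]
  exact L.smul_mem r hv

/-- `σ` is the nontrivial automorphism of the quadratic field, expressed through its effect
on the generator of the inverse different. -/
structure IsConj (d : ℤ) (s : F) (σ : F ≃ₐ[ℚ] F) : Prop where
  conj_conj : ∀ x, σ (σ x) = x
  invDiff_ne_zero : invDiff d s ≠ 0
  conj_invDiff : σ (invDiff d s) = -invDiff d s
  exists_rat : ∀ x, σ x = x → ∃ a : ℚ, x = a

/-- The signature basis is orthogonal with nonzero norms, so a functional is represented by dividing
its values on that basis by the norms. The conjugate compensates for conjugate linearity in the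
second slot. -/
theorem IsHermitianLattice.exists_form_eq (hL : IsHermitianLattice d s h n L)
    (hc : IsConj d s σ) (g : V →ₗ[F] F) : ∃ w, ∀ v, h v w = g v := by
  obtain ⟨b, q, horth, hdiag, h0, hneg⟩ := hL.signature
  have hq : ∀ i, (q i : F) ≠ 0 := fun i => by
    by_cases hi : i = 0
    · subst hi
      exact_mod_cast h0.ne'
    · exact_mod_cast (hneg i hi).ne
  refine ⟨∑ i, σ (g (b i) / q i) • b i, fun v => ?_⟩
  have key : ∀ j, h (b j) (∑ i, σ (g (b i) / q i) • b i) = g (b j) := fun j => by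
    rw [map_sum, Finset.sum_eq_single j, form_smul_right, hc.conj_conj, hdiag, div_mul_cancel₀ _ (hq j)]
    · intro i _ hij
      rw [form_smul_right, horth j i hij.symm, mul_zero]
    · simp
  generalize ∑ i, σ (g (b i) / q i) • b i = w at key
  have : h.flip w = g := b.ext key
  exact congrArg (fun f : V →ₗ[F] F => f v) this

theorem IsHermitianLattice.eq_zero (hL : IsHermitianLattice d s h n L)
    (hc : IsConj d s σ) {u : V} (hu : ∀ v, h v u = 0) : u = 0 := by
  rw [← Module.forall_dual_apply_eq_zero_iff F u]
  intro g
  obtain ⟨w, hw⟩ := hL.exists_form_eq hc g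
  rw [← hw u, hL.hermitian, hu, map_zero]

/-- A basis `β` of the lattice together with vectors `w i` that represent, up to the generator
of the inverse different, its coordinate functions. -/
theorem IsHermitianLattice.exists_frame [IsPrincipalIdealRing (𝓞 F)]
    (hL : IsHermitianLattice d s h n L) (hc : IsConj d s σ) :
    ∃ (m : ℕ) (β : Module.Basis (Fin m) F V) (w : Fin m → V),
      (∀ v, v ∈ L ↔ ∀ i, IsInt (β.repr v i)) ∧ ∀ v i, h v (w i) = invDiff d s * β.repr v i := by
  have := hL.lattice
  have : Module.IsTorsionFree (𝓞 F) V := Module.IsTorsionFree.trans_faithfulSMul (𝓞 F) F V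
  have : Module.Finite (𝓞 F) L := Module.Finite.iff_fg.2 Submodule.IsLattice.fg
  obtain ⟨m, b⟩ := Module.basisOfFiniteTypeTorsionFree' (R := 𝓞 F) (M := L)
  have hb : ∀ i, b.extendOfIsLattice F i = (b i : V) := fun i => by simp
  have hmem : ∀ v, v ∈ L ↔ ∀ i, IsInt ((b.extendOfIsLattice F).repr v i) := by
    intro v
    constructor
    · intro hv i
      refine ⟨b.repr ⟨v, hv⟩ i, ?_⟩
      have e : v = ∑ i, (b.repr ⟨v, hv⟩ i : F) • b.extendOfIsLattice F i := by
        simp only [hb, coe_smul_eq]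
        have h1 := congrArg (Submodule.subtype L) (b.sum_repr ⟨v, hv⟩)
        rw [map_sum] at h1
        exact h1.symm
      conv_rhs => rw [e]
      rw [Module.Basis.repr_sum_self]
    · intro hv
      rw [← (b.extendOfIsLattice F).sum_repr v]
      refine L.sum_mem fun i _ => (hv i).smul_mem ?_
      rw [hb]
      exact (b i).2
  choose w hw using fun i => hL.exists_form_eq hc
    (invDiff d s • (b.extendOfIsLattice F).coord i)
  refine ⟨m, b.extendOfIsLattice F, w, hmem, fun v i => ?_⟩
  rw [hw]
  simp

/-- Conjugate symmetry of the integrality condition. -/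
theorem IsHermitianLattice.swap (hL : IsHermitianLattice d s h n L) (hc : IsConj d s σ) {v w : V}
    (hvw : ∃ x : 𝓞 F, h v w = invDiff d s * x) : ∃ x : 𝓞 F, h w v = invDiff d s * x := by
  obtain ⟨x, hx⟩ := hvw
  obtain ⟨y, hy⟩ := ((isInt_coe x).map σ).neg
  refine ⟨y, ?_⟩
  rw [hL.hermitian, hx, map_mul, hc.conj_invDiff, hy]
  ring

theorem IsHermitianLattice.le_dual (hL : IsHermitianLattice d s h n L) :
    L ≤ dualLattice d s h L := fun v hv w hw => hL.integral v hv w hw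

/-- The lattice is its own bidual. -/
theorem IsHermitianLattice.mem_of_bidual [IsPrincipalIdealRing (𝓞 F)]
    (hL : IsHermitianLattice d s h n L) (hc : IsConj d s σ) {a : V}
    (ha : ∀ v ∈ dualLattice d s h L, ∃ x : 𝓞 F, h v a = invDiff d s * x) : a ∈ L := by
  obtain ⟨m, β, w, hmem, hw⟩ := hL.exists_frame hc
  rw [hmem]
  intro i
  -- The vectors w i form the dual basis up to ∂: pairing a with them reads off its coordinates,
  -- which are thereby integral.
  have hwi : w i ∈ dualLattice d s h L := fun l hl => by
    apply hL.swap hc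
    obtain ⟨r, hr⟩ := (hmem l).1 hl i
    exact ⟨r, by rw [hw, hr]⟩
  obtain ⟨x, hx⟩ := hL.swap hc (ha _ hwi)
  rw [hw] at hx
  exact ⟨x, (mul_left_cancel₀ hc.invDiff_ne_zero hx).symm⟩

/-- Let c be the gcd of the coordinates of e. Then e/c lies in L, hence in I by primitivity, so c is
a unit; a Bézout relation among the coordinates is the functional f. Its representing vector w is
the source of the 𝓞/4 summand later on. -/
theorem IsHermitianLattice.exists_primitive_functional [IsPrincipalIdealRing (𝓞 F)]
    (hL : IsHermitianLattice d s h n L) (hc : IsConj d s σ) (hI : IsCusp h L I) {e : V}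
    (he : I = Submodule.span (𝓞 F) {e}) :
    ∃ (f : V →ₗ[F] F) (w : V), f e = 1 ∧ (∀ v ∈ L, IsInt (f v)) ∧
      w ∈ dualLattice d s h L ∧ ∀ v, h v w = invDiff d s * f v := by
  obtain ⟨m, β, w, hmem, hw⟩ := hL.exists_frame hc
  have : Module.IsTorsionFree (𝓞 F) V := Module.IsTorsionFree.trans_faithfulSMul (𝓞 F) F V
  have heI : e ∈ I := he ▸ Submodule.mem_span_singleton_self e
  have he0 : e ≠ 0 := by
    rintro rfl
    have := hI.rank_one
    rw [he, Submodule.span_zero_singleton, finrank_bot] at this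
    exact zero_ne_one this
  choose r hr using (hmem e).1 (hI.le heI)
  obtain ⟨c, hcs⟩ := (IsPrincipalIdealRing.principal (Ideal.span (Set.range r))).principal
  have hdvd : ∀ i, c ∣ r i := fun i => by
    rw [← Ideal.mem_span_singleton, ← Ideal.submodule_span_eq, ← hcs]
    exact Ideal.subset_span ⟨i, rfl⟩
  choose r' hr' using hdvd
  have hec : e = c • ∑ i, (r' i : F) • β i := by
    rw [← coe_smul_eq, Finset.smul_sum]
    conv_lhs => rw [← β.sum_repr e]
    refine Finset.sum_congr rfl fun i _ => ?_
    rw [smul_smul, ← hr, hr' i]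
    rfl
  have hc0 : c ≠ 0 := by
    rintro rfl
    exact he0 (by rw [hec, zero_smul])
  have hprim : ∑ i, (r' i : F) • β i ∈ I := by
    refine hI.primitive _ ?_ c hc0 (hec ▸ heI)
    rw [hmem]
    intro i
    rw [Module.Basis.repr_sum_self]
    exact isInt_coe _
  rw [he, Submodule.mem_span_singleton] at hprim
  obtain ⟨x, hx⟩ := hprim
  have hcx : c * x = 1 := by
    rw [← hx, smul_smul] at hec
    have h0 : (c * x - 1) • e = 0 := by rw [sub_smul, one_smul, ← hec, sub_self]
    exact sub_eq_zero.1 ((smul_eq_zero.1 h0).resolve_right he0)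
  have h1 : (1 : 𝓞 F) ∈ Ideal.span (Set.range r) := by
    rw [hcs, Ideal.submodule_span_eq, Ideal.mem_span_singleton]
    exact ⟨x, hcx.symm⟩
  rw [Ideal.span, Submodule.mem_span_range_iff_exists_fun] at h1
  obtain ⟨a, ha⟩ := h1
  have hfL : ∀ v ∈ L, IsInt ((∑ i, (a i : F) • β.coord i) v) := by
    intro v hv
    simp only [LinearMap.sum_apply, LinearMap.smul_apply, Module.Basis.coord_apply, smul_eq_mul]
    choose t ht using (hmem v).1 hv
    refine ⟨∑ i, a i * t i, ?_⟩
    refine (map_sum (algebraMap (𝓞 F) F) _ _).trans (Finset.sum_congr rfl fun i _ => ?_)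
    rw [← ht i]
    exact map_mul (algebraMap (𝓞 F) F) _ _
  obtain ⟨u, hu⟩ := hL.exists_form_eq hc (invDiff d s • ∑ i, (a i : F) • β.coord i)
  refine ⟨∑ i, (a i : F) • β.coord i, u, ?_, hfL, fun l hl => ?_, fun v => ?_⟩
  · simp only [LinearMap.sum_apply, LinearMap.smul_apply, Module.Basis.coord_apply, smul_eq_mul]
    have := congrArg (algebraMap (𝓞 F) F) ha
    simpa [← hr] using this
  · apply hL.swap hc
    obtain ⟨y, hy⟩ := hfL l hl
    exact ⟨y, by rw [hu, LinearMap.smul_apply, ← hy, smul_eq_mul]⟩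
  · rw [hu, LinearMap.smul_apply, smul_eq_mul]

theorem IsCusp.exists_generator [IsPrincipalIdealRing (𝓞 F)]
    (hL : IsHermitianLattice d s h n L) (hI : IsCusp h L I) :
    ∃ e : V, I = Submodule.span (𝓞 F) {e} := by
  have := hL.lattice
  have : Module.IsTorsionFree (𝓞 F) V := Module.IsTorsionFree.trans_faithfulSMul (𝓞 F) F V
  have hfin : Module.Finite (𝓞 F) L := Module.Finite.iff_fg.2 Submodule.IsLattice.fg
  have : Module.Finite (𝓞 F) I :=
    Module.Finite.of_injective (Submodule.inclusion hI.le) (Submodule.inclusion_injective _)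
  obtain ⟨v, hv⟩ := finrank_eq_one_iff'.1 hI.rank_one
  obtain ⟨-, hv⟩ := hv
  refine ⟨v, le_antisymm (fun w hw => ?_) ?_⟩
  · obtain ⟨c, hcw⟩ := hv ⟨w, hw⟩
    exact Submodule.mem_span_singleton.2 ⟨c, congrArg Subtype.val hcw⟩
  · rw [Submodule.span_le, Set.singleton_subset_iff]
    exact v.2

/-- The ideal `{⟨ℓ, e⟩ | ℓ ∈ L}` is principal. -/
theorem IsCusp.exists_isDiv [IsPrincipalIdealRing (𝓞 F)]
    (hL : IsHermitianLattice d s h n L) (hI : IsCusp h L I) : ∃ δ : F, IsDiv h L I δ := by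
  obtain ⟨e, he⟩ := hI.exists_generator hL
  have heL : e ∈ L := hI.le (he ▸ Submodule.mem_span_singleton_self e)
  -- Dividing by ∂ turns the fractional ideal of values into an ordinary ideal, which has a
  -- generator.
  let J : Ideal (𝓞 F) :=
    { carrier := {x | ∃ l ∈ L, h l e = invDiff d s * x}
      zero_mem' := ⟨0, L.zero_mem, by simp⟩
      add_mem' := by
        rintro x y ⟨l, hl, hx⟩ ⟨l', hl', hy⟩
        refine ⟨l + l', L.add_mem hl hl', ?_⟩
        rw [form_add_left, hx, hy, ← mul_add]
        rfl
      smul_mem' := by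
        rintro c x ⟨l, hl, hx⟩
        refine ⟨c • l, L.smul_mem c hl, ?_⟩
        rw [← coe_smul_eq, form_smul_left, hx, smul_eq_mul, mul_left_comm]
        rfl }
  obtain ⟨m, hm⟩ := (IsPrincipalIdealRing.principal J).principal
  refine ⟨invDiff d s * m, e, he, fun y => ⟨?_, ?_⟩⟩
  · rintro ⟨l, hl, rfl⟩
    obtain ⟨x, hx⟩ := hL.integral l hl e heL
    have hxJ : x ∈ J := ⟨l, hl, hx⟩
    rw [hm, Ideal.submodule_span_eq, Ideal.mem_span_singleton] at hxJ
    obtain ⟨y, rfl⟩ := hxJ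
    refine ⟨y, ?_⟩
    rw [hx, mul_left_comm, mul_comm m y]
    rfl
  · rintro ⟨x, rfl⟩
    have hxJ : x * m ∈ J := by
      rw [hm, Ideal.submodule_span_eq, Ideal.mem_span_singleton]
      exact Dvd.intro_left x rfl
    obtain ⟨l, hl, hx⟩ := hxJ
    refine ⟨l, hl, ?_⟩
    rw [hx, mul_left_comm]
    rfl

end HermitianLattice

/-! ### Unitary transvections and their arithmetic constraints. -/

section Transvection

variable {F V : Type*} [Field F] [NumberField F] [AddCommGroup V] [Module F V]
  {σ : F ≃ₐ[ℚ] F} [Module (𝓞 F) V] [IsScalarTower (𝓞 F) F V]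
  {d : ℤ} {s : F} {h : V →ₗ[F] V →ₛₗ[(σ : F →+* F)] F} {n : ℕ} {L I : Submodule (𝓞 F) V}

theorem forall_span_form_eq_zero_iff {e v : V} :
    (∀ w ∈ Submodule.span (𝓞 F) {e}, h v w = 0) ↔ h v e = 0 := by
  refine ⟨fun H => H e (Submodule.mem_span_singleton_self e), fun H w hw => ?_⟩
  obtain ⟨c, rfl⟩ := Submodule.mem_span_singleton.1 hw
  rw [← coe_smul_eq, form_smul_right, H, mul_zero]

/-- Elements of the centre of the unipotent radical are unitary transvections. -/
theorem IsHermitianLattice.exists_transvection (hL : IsHermitianLattice d s h n L)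
    (hc : IsConj d s σ) {e : V} (hee : h e e = 0) {f : V →ₗ[F] F} (hfe : f e = 1) {g : V ≃ₗ[F] V}
    (hg : g ∈ centreU h (Submodule.span (𝓞 F) {e})) :
    ∃ t : F, σ t = -t ∧ ∀ v, g v = v + (t * h v e) • e := by
  obtain ⟨u, hu⟩ := hL.exists_form_eq hc f
  have hue : h u e = 1 := by rw [hL.hermitian, hu, hfe, map_one]
  have heu : h e u = 1 := by rw [hu, hfe]
  have hfix : ∀ v, h v e = 0 → g v = v := fun v hv => hg.2 v (forall_span_form_eq_zero_iff.2 hv)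
  -- Each w is (w - ⟨w, e⟩u) plus a multiple of u, and the first part is orthogonal to e, hence
  -- fixed by g. So pairing w with gu - u gives a constant times ⟨w, e⟩, and nondegeneracy makes gu
  -- - u a multiple of e.
  have hgu : g u - u = σ (h u (g u - u)) • e := by
    rw [← sub_eq_zero]
    refine hL.eq_zero hc fun w => ?_
    have hw0 : h (w - h w e • u) e = 0 := by
      rw [form_sub_left, form_smul_left, hue, mul_one, sub_self]
    have h1 : h (w - h w e • u) (g u) = h (w - h w e • u) u := by
      conv_lhs => rw [← hfix _ hw0]
      exact hg.1.1 _ _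
    have h2 : h w (g u - u) = h w e * h u (g u - u) := by
      rw [form_sub_left, form_sub_left, form_smul_left, form_smul_left] at h1
      rw [map_sub, map_sub]
      linear_combination h1
    rw [map_sub, form_smul_right, hc.conj_conj, h2]
    ring
  set t := σ (h u (g u - u)) with ht
  have hgu' : g u = u + t • e := by rw [← hgu]; abel
  refine ⟨t, ?_, fun v => ?_⟩
  -- Expanding ⟨gu, gu⟩ = ⟨u, u⟩ leaves t + σ(t) = 0.
  · have h3 := hg.1.1 u u
    rw [hgu', map_add, form_add_left, form_add_left, form_smul_right, form_smul_right,
      form_smul_left, form_smul_left, hee, hue, heu] at h3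
    linear_combination h3
  · have hw0 : h (v - h v e • u) e = 0 := by
      rw [form_sub_left, form_smul_left, hue, mul_one, sub_self]
    have h4 := hfix _ hw0
    rw [map_sub, map_smul, hgu', smul_add, smul_smul, sub_eq_iff_eq_add] at h4
    rw [h4, mul_comm (h v e) t]
    abel

/-- Homotheties commute with Γ, so products in the generated group can be sorted into a power of x
times an element of Γ. -/
theorem exists_zpow_smul_of_mem_withScalar {Γ : Subgroup (V ≃ₗ[F] V)} {x : F} (hx : x ≠ 0)
    {g : V ≃ₗ[F] V} (hg : g ∈ withScalar Γ x) : ∃ (k : ℤ), ∃ γ ∈ Γ, ∀ v, g v = x ^ k • γ v := by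
  refine Subgroup.closure_induction (p := fun g _ => ∃ (k : ℤ), ∃ γ ∈ Γ, ∀ v, g v = x ^ k • γ v)
    ?_ ?_ ?_ ?_ hg
  · rintro g (hg | hg)
    · exact ⟨0, g, hg, fun v => by simp⟩
    · exact ⟨1, 1, one_mem _, fun v => by simpa using hg v⟩
  · exact ⟨0, 1, one_mem _, fun v => by simp⟩
  · rintro g g' - - ⟨k, γ, hγ, H⟩ ⟨k', γ', hγ', H'⟩
    refine ⟨k + k', γ * γ', mul_mem hγ hγ', fun v => ?_⟩
    rw [LinearEquiv.mul_apply, LinearEquiv.mul_apply, H, H', map_smul, smul_smul, zpow_add₀ hx]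
  · rintro g - ⟨k, γ, hγ, H⟩
    refine ⟨-k, γ⁻¹, inv_mem hγ, fun v => ?_⟩
    have e : ∀ u, γ (γ⁻¹ u) = u := fun u => γ.apply_symm_apply u
    apply g.injective
    rw [show g (g⁻¹ v) = v from g.apply_symm_apply v, H, map_smul, e, smul_smul, ← zpow_add₀ hx]
    simp

theorem le_withScalar (Γ : Subgroup (V ≃ₗ[F] V)) (x : F) : Γ ≤ withScalar Γ x :=
  fun _ hg => Subgroup.subset_closure (Or.inl hg)

theorem exists_of_arithU_ne {Γ Γ' : Subgroup (V ≃ₗ[F] V)} (hle : Γ ≤ Γ')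
    (hne : arithU h I Γ ≠ arithU h I Γ') : ∃ g ∈ centreU h I, g ∈ Γ' ∧ g ∉ Γ := by
  by_contra! H
  exact hne (Set.Subset.antisymm (fun g hg => ⟨hg.1, hle hg.2⟩) fun g hg => ⟨hg.1, H g hg.1 hg.2⟩)

/-- A transvection `v ↦ v + τ (⟨v, e⟩ / ∂) e` with `τ` an integer lies in the discriminant
kernel. -/
theorem IsHermitianLattice.mem_discKernel (hL : IsHermitianLattice d s h n L)
    (hc : IsConj d s σ) {e : V} (heL : e ∈ L) (hee : h e e = 0) {τ : F} (hτ : IsInt τ)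
    {g : V ≃ₗ[F] V} (hgu : g ∈ unitaryGroup h)
    (hg : ∀ v, g v = v + (τ * (invDiff d s)⁻¹ * h v e) • e) : g ∈ discKernel d s h L := by
  have key : ∀ v, (∃ x : 𝓞 F, h v e = invDiff d s * x) →
      (τ * (invDiff d s)⁻¹ * h v e) • e ∈ L := by
    rintro v ⟨x, hx⟩
    rw [hx, mul_assoc, inv_mul_cancel_left₀ hc.invDiff_ne_zero]
    exact (hτ.mul (isInt_coe x)).smul_mem heL
  refine ⟨⟨hgu, fun v => ⟨fun hv => ?_, fun hv => ?_⟩⟩, fun v hv => ?_⟩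
  · have h1 : h v e = h (g v) e := by rw [hg, form_add_left, form_smul_left, hee]; ring
    have h2 := key v (h1 ▸ hL.integral _ hv _ heL)
    have h3 := L.sub_mem hv h2
    rwa [hg v, add_sub_cancel_right] at h3
  · rw [hg]
    exact L.add_mem hv (key v (hL.integral _ hv _ heL))
  · rw [hg, add_sub_cancel_left]
    exact key v (hv e heL)

/-- The arithmetic constraints on a transvection that is `c` times an element of the discriminant
kernel. -/
theorem IsHermitianLattice.transvection_constraints [IsPrincipalIdealRing (𝓞 F)]
    (hL : IsHermitianLattice d s h n L) (hc : IsConj d s σ) (hI : IsCusp h L I) {e : V}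
    (he : I = Submodule.span (𝓞 F) {e}) {δ : F}
    (hδ : ∀ y : F, (∃ l ∈ L, h l e = y) ↔ ∃ x : 𝓞 F, y = x * δ) {g γ : V ≃ₗ[F] V}
    (hg : g ∈ centreU h I) (hγ : γ ∈ discKernel d s h L) {c : F} (hcI : IsInt c)
    (hgc : ∀ v, g v = c • γ v) :
    ∃ (τ : ℚ) (m r : F), IsInt m ∧ IsInt r ∧ δ = invDiff d s * m ∧ IsInt (τ * m) ∧
      m * r = σ (1 - c) ∧ ((∃ k : ℤ, τ = k) → g ∈ discKernel d s h L) ∧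
      ∀ v ∈ dualLattice d s h L, ∀ x : F, h v e = invDiff d s * x →
        (1 - c) • v + (τ * x) • e ∈ L := by
  have heI : e ∈ I := he ▸ Submodule.mem_span_singleton_self e
  have heL := hI.le heI
  have hee := hI.isotropic e heI e heI
  have hd0 := hc.invDiff_ne_zero
  obtain ⟨f, w, hfe, hfL, hwd, hfw⟩ := hL.exists_primitive_functional hc hI he
  obtain ⟨t, hσt, hgt⟩ := hL.exists_transvection hc hee hfe (he ▸ hg)
  -- Both t and ∂ change sign under conjugation, so their product is rational.
  obtain ⟨τ, hτ⟩ := hc.exists_rat (t * invDiff d s) (by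
    rw [map_mul, hσt, hc.conj_invDiff]; ring)
  have ht : t = τ * (invDiff d s)⁻¹ := by rw [← hτ]; field_simp
  -- This is c(γv - v) ∈ L rewritten through cγv = gv = v + τxe.
  have key : ∀ v ∈ dualLattice d s h L, ∀ x : F, h v e = invDiff d s * x →
      (1 - c) • v + (τ * x) • e ∈ L := by
    intro v hv x hx
    have h1 := hcI.smul_mem (hγ.2 v hv)
    rw [smul_sub, ← hgc, hgt, hx, ← mul_assoc, hτ] at h1
    convert h1 using 1
    rw [sub_smul, one_smul]
    abel
  obtain ⟨l, hl, hle⟩ := (hδ δ).2 ⟨1, by simp⟩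
  obtain ⟨m, hm⟩ := hL.integral l hl e heL
  rw [hle] at hm
  -- Otherwise e would be orthogonal to all of V, against ⟨e, w⟩ = ∂.
  have hδ0 : (m : F) ≠ 0 := by
    intro h0
    have hle : Submodule.span F (L : Set V) ≤ LinearMap.ker (h.flip e) := by
      refine Submodule.span_le.2 fun l' hl' => ?_
      obtain ⟨x, hx⟩ := (hδ _).1 ⟨l', hl', rfl⟩
      rw [SetLike.mem_coe, LinearMap.mem_ker, LinearMap.flip_apply, hx, hm, h0, mul_zero, mul_zero]
    have hwe : h w e = 0 := by
      have := hL.lattice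
      rw [Submodule.IsLattice.span_eq_top] at hle
      exact hle (Submodule.mem_top (x := w))
    have hew := hfw e
    rw [hL.hermitian, hwe, hfe, map_zero, mul_one] at hew
    exact hd0 hew.symm
  -- All products ⟨e, ℓ⟩ lie in σ(∂m)𝓞. This isotropic test vector makes the term with τ vanish from
  -- `key`, leaving (1 - c)/σ(m) ∈ 𝓞.
  have hdual : (σ (m : F))⁻¹ • e ∈ dualLattice d s h L := by
    intro l' hl'
    obtain ⟨x, hx⟩ := (hδ _).1 ⟨l', hl', rfl⟩
    obtain ⟨y, hy⟩ := ((isInt_coe x).map σ).neg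
    refine ⟨y, ?_⟩
    have hσm : σ (m : F) ≠ 0 := by simpa using hδ0
    rw [form_smul_left, hL.hermitian, hx, hm, map_mul, map_mul, hc.conj_invDiff, hy]
    field_simp
  have hr := hfL _ (key _ hdual 0 (by rw [form_smul_left, hee, mul_zero, mul_zero]))
  rw [mul_zero, zero_smul, add_zero, map_smul, map_smul, hfe, smul_eq_mul, smul_eq_mul,
    mul_one] at hr
  -- Second test vector: l is in L with ⟨l, e⟩ = ∂m, so (1 - c)l can be subtracted and τme ∈ L
  -- remains; f reads off its coefficient.
  have hτm := hfL _ (L.sub_mem (key l (hL.le_dual hl) m (hle.trans hm))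
    ((IsInt.sub (isInt_iff.2 isIntegral_one) hcI).smul_mem hl))
  rw [add_sub_cancel_left, map_smul, hfe, smul_eq_mul, mul_one] at hτm
  refine ⟨τ, m, σ ((1 - c) * (σ (m : F))⁻¹), isInt_coe m, hr.map σ, hm, hτm, ?_, ?_, key⟩
  · rw [map_mul, map_inv₀, hc.conj_conj, mul_left_comm, mul_inv_cancel₀ hδ0, mul_one]
  · rintro ⟨k, rfl⟩
    refine hL.mem_discKernel hc heL hee (isInt_intCast k) hg.1.1 fun v => ?_
    rw [hgt, ht]
    simp

end Transvection

/-! ### Consequences for roots of unity of order 2, 4 and 3. -/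

section Constraints

variable {F : Type*} [Field F] [NumberField F]

theorem isInt_one : IsInt (1 : F) := isInt_iff.2 isIntegral_one

theorem not_isInt_inv_natCast {k : ℕ} (hk : 1 < k) : ¬ IsInt ((k : F)⁻¹) := by
  intro H
  obtain ⟨j, hj⟩ := exists_int_of_isInt_ratCast (F := F) (q := (k : ℚ)⁻¹) (by simpa using H)
  have h0 : (k : ℚ) ≠ 0 := by exact_mod_cast (by omega : k ≠ 0)
  have h1 : (1 : ℚ) = (k * j : ℤ) := by push_cast; rw [← hj, mul_inv_cancel₀ h0]
  have h2 : (1 : ℤ) = k * j := by exact_mod_cast h1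
  have := Int.eq_one_or_neg_one_of_mul_eq_one h2.symm
  omega

/-- Multiplying τm by r shows that 2τ is integral, hence an integer, necessarily odd. -/
theorem exists_half_of_not_int {τ : ℚ} {m r : F} (hτm : IsInt (τ * m)) (hr : IsInt r)
    (hmr : m * r = 2) (hτ : ¬ ∃ k : ℤ, τ = k) : ∃ k : ℤ, τ = k + 1 / 2 := by
  obtain ⟨j, hj⟩ := exists_int_of_isInt_ratCast (F := F) (q := 2 * τ) (by
    convert hτm.mul hr using 1
    push_cast
    rw [mul_assoc, hmr, mul_comm])
  rcases Int.even_or_odd' j with ⟨k, rfl | rfl⟩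
  · exact absurd ⟨k, by push_cast at hj; linarith⟩ hτ
  · exact ⟨k, by push_cast at hj; linarith⟩

theorem isInt_half_of_half {k : ℤ} {m : F} (hm : IsInt m)
    (hτm : IsInt (((k + 1 / 2 : ℚ) : F) * m)) : IsInt (m / 2) := by
  convert hτm.sub ((isInt_intCast k).mul hm) using 1
  push_cast
  ring

theorem exists_unit_of_half {k : ℤ} {m r : F} (hm : IsInt m) (hr : IsInt r)
    (hτm : IsInt (((k + 1 / 2 : ℚ) : F) * m)) (hmr : m * r = 2) :
    ∃ u : (𝓞 F)ˣ, m = 2 * ((u : 𝓞 F) : F) := by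
  obtain ⟨y, hy⟩ := isInt_half_of_half hm hτm
  obtain ⟨r, rfl⟩ := hr
  have hyr : y * r = 1 := by
    apply FaithfulSMul.algebraMap_injective (𝓞 F) F
    rw [map_mul, map_one]
    change (y : F) * r = 1
    rw [hy]
    linear_combination hmr / 2
  exact ⟨Units.mkOfMulEqOne y r hyr, by simp [hy]; ring⟩

/-- A transvection cannot be a nontrivial fourth root of unity times an element of the
discriminant kernel, unless it is in the kernel. -/
theorem int_of_sq_eq_neg_one {τ : ℚ} {m r c : F} (hm : IsInt m) (hr : IsInt r) (hc : IsInt c)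
    (hτm : IsInt (τ * m)) (hc2 : c ^ 2 = -1) (hmr : m * r = 1 + c) : ∃ k : ℤ, τ = k := by
  by_contra hτ
  have hmr' : m * (r * (1 - c)) = 2 := by linear_combination (1 - c) * hmr - hc2
  obtain ⟨k, rfl⟩ := exists_half_of_not_int hτm (hr.mul (isInt_one.sub hc)) hmr' hτ
  have h1 := (isInt_half_of_half hm hτm).mul hr
  -- The element (1 + c)/2 would be integral, but its square is c/2, and multiplying by -c gives
  -- 1/2.
  have h2 := (h1.mul h1).mul hc.neg
  refine not_isInt_inv_natCast (F := F) one_lt_two ?_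
  convert h2 using 1
  have h3 : m / 2 * r = (1 + c) / 2 := by rw [← hmr]; ring
  rw [h3]
  push_cast
  linear_combination (2 + c) / 4 * hc2

/-- A transvection cannot be a nontrivial cube root of unity times an element of the
discriminant kernel, unless it is in the kernel. -/
theorem int_of_cube_root {τ : ℚ} {m r c : F} (hm : IsInt m) (hr : IsInt r) (hc : IsInt c)
    (hτm : IsInt (τ * m)) (hc2 : c ^ 2 + c + 1 = 0) (hmr : m * r = 1 - c) : ∃ k : ℤ, τ = k := by
  have hmr' : m * (r * (2 + c)) = 3 := by linear_combination (2 + c) * hmr - hc2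
  obtain ⟨j, hj⟩ := exists_int_of_isInt_ratCast (F := F) (q := 3 * τ) (by
    convert hτm.mul (hr.mul ((isInt_intCast 2).add hc)) using 1
    push_cast
    rw [mul_assoc, hmr', mul_comm])
  rcases (by omega : j % 3 = 0 ∨ j % 3 = 1 ∨ j % 3 = 2) with h0 | h12
  · refine ⟨j / 3, ?_⟩
    have : j = 3 * (j / 3) := by omega
    have h' : (j : ℚ) = 3 * ((j / 3 : ℤ) : ℚ) := by exact_mod_cast this
    linarith
  · exfalso
    -- With τ = j/3 and j² = 3i + 1, the combination j(τm) - im equals m/3, which is therefore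
    -- integral.
    obtain ⟨i, hi⟩ : ∃ i : ℤ, j * j = 3 * i + 1 := by
      refine ⟨j * j / 3, ?_⟩
      have : j * j % 3 = 1 := by rcases h12 with h | h <;> simp [Int.mul_emod, h]
      omega
    have hτ : (τ : F) = j / 3 := by
      have : τ = j / 3 := by linarith
      rw [this]
      push_cast
      rfl
    have hm3 : IsInt (m / 3) := by
      convert ((isInt_intCast j).mul hτm).sub ((isInt_intCast i).mul hm) using 1
      rw [hτ]
      have hi' : (j : F) * j = 3 * i + 1 := by exact_mod_cast congrArg (Int.cast : ℤ → F) hi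
      linear_combination -m / 3 * hi'
    have h1 := hm3.mul hr
    -- Now (1 - c)/3 would be integral; its square is -c/3, and multiplying by -c² gives 1/3.
    have h2 := (h1.mul h1).mul (hc.mul hc).neg
    refine not_isInt_inv_natCast (F := F) (k := 3) (by norm_num) ?_
    convert h2 using 1
    have h3 : m / 3 * r = (1 - c) / 3 := by rw [← hmr]; ring
    rw [h3]
    push_cast
    linear_combination (c ^ 2 - 3 * c + 3) / 9 * hc2

end Constraints

/-! ### Splitting off 𝓞/4 from the discriminant group. -/

section Splitting

variable {F V : Type*} [Field F] [NumberField F] [AddCommGroup V] [Module F V]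
  {σ : F ≃ₐ[ℚ] F} [Module (𝓞 F) V] [IsScalarTower (𝓞 F) F V]
  {d : ℤ} {s : F} {h : V →ₗ[F] V →ₛₗ[(σ : F →+* F)] F} {n : ℕ} {L I : Submodule (𝓞 F) V}

/-- A linear map to `F` with integral values, as a map to the ring of integers. -/
theorem exists_lift_of_isInt {M : Type*} [AddCommGroup M] [Module (𝓞 F) M] (φ : M →ₗ[𝓞 F] F)
    (hφ : ∀ x, IsInt (φ x)) : ∃ ψ : M →ₗ[𝓞 F] 𝓞 F, ∀ x, (ψ x : F) = φ x := by
  choose ψ hψ using hφ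
  have hinj := FaithfulSMul.algebraMap_injective (𝓞 F) F
  refine ⟨⟨⟨ψ, fun x y => hinj ?_⟩, fun c x => hinj ?_⟩, hψ⟩
  · exact (hψ _).trans (by rw [map_add, map_add]; exact congrArg₂ _ (hψ x).symm (hψ y).symm)
  · refine (hψ _).trans ?_
    rw [map_smul, RingHom.id_apply, smul_eq_mul, map_mul, Algebra.smul_def]
    exact congrArg _ (hψ x).symm

/-- The class of w and the functional 4f give maps 𝓞/4 → A_L → 𝓞/4 whose composite is multiplication
by 4f(w) = 1 + 2a. Rescaling by 1 - 2a makes it the identity, because (1 - 2a)(1 + 2a) = 1 - 4a².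
The complement is the kernel of the rescaled functional. -/
theorem IsHermitianLattice.exists_splitting [IsPrincipalIdealRing (𝓞 F)]
    (hL : IsHermitianLattice d s h n L) (hc : IsConj d s σ) (hI : IsCusp h L I) {e : V}
    (he : I = Submodule.span (𝓞 F) {e}) {k : ℤ}
    (key : ∀ v ∈ dualLattice d s h L, ∀ x : F, h v e = invDiff d s * x →
        (2 : F) • v + (((k + 1 / 2 : ℚ) : F) * x) • e ∈ L) :
    Module.Finite (𝓞 F) (DiscGroup d s h L) ∧
    ∃ C : Submodule (𝓞 F) (DiscGroup d s h L), (∀ x ∈ C, (2 : 𝓞 F) • x = 0) ∧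
      Nonempty (DiscGroup d s h L ≃ₗ[𝓞 F] C × (𝓞 F ⧸ Ideal.span {(4 : 𝓞 F)})) := by
  have heI : e ∈ I := he ▸ Submodule.mem_span_singleton_self e
  have heL := hI.le heI
  obtain ⟨f, w, hfe, hfL, hwd, hfw⟩ := hL.exists_primitive_functional hc hI he
  -- Doubling `key` clears the half: 4v + (2k + 1)xe ∈ L, and the second term is in L.
  have hfour : ∀ v ∈ dualLattice d s h L, (4 : F) • v ∈ L := by
    intro v hv
    obtain ⟨x, hx⟩ := hv e heL
    have h1 := (isInt_intCast 2).smul_mem (key v hv x hx)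
    have h2 := ((isInt_intCast (2 * k + 1)).mul (isInt_coe x)).smul_mem heL
    convert L.sub_mem h1 h2 using 1
    push_cast
    module
  have hwe : h w e = invDiff d s * (-1) := by
    rw [hL.hermitian, hfw, hfe, mul_one, hc.conj_invDiff, mul_neg_one]
  -- Here a = 2f(w) - 1/2, so 4f(w) = 2a + 1.
  obtain ⟨a, ha⟩ := (hfL _ (key w hwd (-1) hwe)).add (isInt_intCast k)
  have hfin : Module.Finite (𝓞 F) (dualLattice d s h L) := by
    have := hL.lattice
    have : Module.IsTorsionFree (𝓞 F) V := Module.IsTorsionFree.trans_faithfulSMul (𝓞 F) F V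
    have : Module.Finite (𝓞 F) L := Module.Finite.iff_fg.2 Submodule.IsLattice.fg
    let μ : dualLattice d s h L →ₗ[𝓞 F] L :=
      LinearMap.codRestrict L ((4 : 𝓞 F) • (dualLattice d s h L).subtype) fun v => by
        have := hfour v v.2
        rwa [show (4 : F) = ((4 : 𝓞 F) : F) from (map_ofNat (algebraMap (𝓞 F) F) 4).symm,
          coe_smul_eq] at this
    refine Module.Finite.of_injective μ fun v v' hvv => ?_
    have h4 : (4 : 𝓞 F) • (v : V) = (4 : 𝓞 F) • (v' : V) := congrArg Subtype.val hvv
    exact Subtype.ext (smul_right_injective V (by norm_num : (4 : 𝓞 F) ≠ 0) h4)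
  refine ⟨inferInstance, ?_⟩
  obtain ⟨ψ, hψ⟩ := exists_lift_of_isInt
    ((((1 - 2 * (a : F)) * 4) • f).restrictScalars (𝓞 F) ∘ₗ (dualLattice d s h L).subtype)
    (fun v => by
      have := (isInt_one.sub ((isInt_intCast 2).mul (isInt_coe a))).mul (hfL _ (hfour v v.2))
      convert this using 1
      simp
      ring)
  replace hψ : ∀ v : dualLattice d s h L, (ψ v : F) = (1 - 2 * a) * 4 * f v := hψ
  have hinj := FaithfulSMul.algebraMap_injective (𝓞 F) F
  have hψL : ∀ v : dualLattice d s h L, (v : V) ∈ L → ψ v ∈ Ideal.span {(4 : 𝓞 F)} := by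
    intro v hv
    obtain ⟨b, hb⟩ := hfL v hv
    rw [Ideal.mem_span_singleton]
    refine ⟨(1 - 2 * a) * b, hinj ?_⟩
    refine (hψ v).trans ?_
    simp only [map_mul, map_sub, map_one, map_ofNat, ← hb]
    ring
  let Ψ : DiscGroup d s h L →ₗ[𝓞 F] 𝓞 F ⧸ Ideal.span {(4 : 𝓞 F)} :=
    Submodule.liftQ _ (Submodule.mkQ _ ∘ₗ ψ) fun v hv => by
      rw [LinearMap.mem_ker, LinearMap.comp_apply, Submodule.mkQ_apply,
        Submodule.Quotient.mk_eq_zero]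
      exact hψL v hv
  have hΨ : ∀ v, Ψ (Submodule.Quotient.mk v) = Submodule.Quotient.mk (ψ v) := fun v => rfl
  have hmk : ∀ v : dualLattice d s h L, (v : V) ∈ L →
      (Submodule.Quotient.mk v : DiscGroup d s h L) = 0 := fun v hv =>
    (Submodule.Quotient.mk_eq_zero _).2 hv
  let j : (𝓞 F ⧸ Ideal.span {(4 : 𝓞 F)}) →ₗ[𝓞 F] DiscGroup d s h L :=
    Submodule.liftQ _ (LinearMap.toSpanSingleton (𝓞 F) (DiscGroup d s h L)
      (Submodule.Quotient.mk ⟨w, hwd⟩)) fun x hx => by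
      obtain ⟨y, rfl⟩ := Ideal.mem_span_singleton.1 hx
      rw [LinearMap.mem_ker, LinearMap.toSpanSingleton_apply, ← Submodule.Quotient.mk_smul]
      apply hmk
      have := L.smul_mem y (hfour w hwd)
      rw [← coe_smul_eq, smul_smul] at this
      change (4 * y) • w ∈ L
      rw [← coe_smul_eq]
      convert this using 2
      exact (map_mul (algebraMap (𝓞 F) F) 4 y).trans (by rw [map_ofNat, mul_comm])
  have hΨj : Ψ ∘ₗ j = LinearMap.id := by
    apply Submodule.linearMap_qext
    ext
    change Ψ ((1 : 𝓞 F) • Submodule.Quotient.mk ⟨w, hwd⟩) = Submodule.Quotient.mk 1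
    rw [one_smul, hΨ, Submodule.Quotient.eq, Ideal.mem_span_singleton]
    refine ⟨-(a ^ 2), hinj ?_⟩
    have h1 : f ((2 : F) • w + (((k + 1 / 2 : ℚ) : F) * (-1)) • e) = 2 * f w - (k + 1 / 2) := by
      rw [map_add, map_smul, map_smul, hfe]
      push_cast
      simp only [smul_eq_mul]
      ring
    have h2 := hψ ⟨w, hwd⟩
    change (ψ ⟨w, hwd⟩ : F) = _ at h2
    rw [h1] at ha
    simp only [map_mul, map_sub, map_one, map_ofNat, map_neg, map_pow]
    rw [show algebraMap (𝓞 F) F (ψ ⟨w, hwd⟩) = _ from h2]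
    have hfw' : f w = (a + 1 / 2) / 2 := by linear_combination -ha / 2
    rw [hfw']
    change _ = 4 * -((a : F) ^ 2)
    ring
  refine ⟨LinearMap.ker Ψ, fun x hx => ?_, ⟨(lequivProdOfRightSplitExact
    (LinearMap.ker Ψ).injective_subtype (Submodule.range_subtype _) hΨj).symm⟩⟩
  obtain ⟨v, rfl⟩ := Submodule.Quotient.mk_surjective _ x
  rw [LinearMap.mem_ker, hΨ, Submodule.Quotient.mk_eq_zero, Ideal.mem_span_singleton] at hx
  obtain ⟨y, hy⟩ := hx
  obtain ⟨x, hx⟩ := v.2 e heL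
  have hk := key v v.2 x hx
  obtain ⟨b, hb⟩ := hfL _ hk
  rw [map_add, map_smul, map_smul, hfe, smul_eq_mul, smul_eq_mul] at hb
  have hy' := congrArg (algebraMap (𝓞 F) F) hy
  rw [show algebraMap (𝓞 F) F (ψ v) = _ from hψ v, map_mul, map_ofNat] at hy'
  -- With b = 2f(v) + (k + 1/2)x, membership in the kernel reads 4y = (1 - 2a)(2b - (2k + 1)x),
  -- which solves for x/2 with integral coefficients. Then (k + 1/2)xe ∈ L, and `key` gives 2v ∈ L.
  have hz : IsInt ((x : F) / 2) := by
    convert (((isInt_coe b).sub ((isInt_intCast k).mul (isInt_coe x))).sub ((isInt_coe a).mul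
      (((isInt_intCast 2).mul (isInt_coe b)).sub ((isInt_intCast (2 * k + 1)).mul
      (isInt_coe x))))).sub ((isInt_intCast 2).mul (isInt_coe y)) using 1
    push_cast at hb ⊢
    linear_combination (2 * (a : F) - 1) * hb - hy' / 2
  rw [← Submodule.Quotient.mk_smul]
  apply hmk
  have hl := L.sub_mem hk (((isInt_intCast (2 * k + 1)).mul hz).smul_mem heL)
  change (2 : 𝓞 F) • (v : V) ∈ L
  rw [← coe_smul_eq]
  convert hl using 1
  rw [show ((2 : 𝓞 F) : F) = 2 from map_ofNat (algebraMap (𝓞 F) F) 2]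
  push_cast
  module

end Splitting

/-! ### Finitely generated torsion modules over a principal ideal domain. -/

section ModuleClassification

open DirectSum in
/-- A finitely generated module over a principal ideal domain killed by `N ≠ 0`, when every prime
power dividing `N` is a unit or associated to `x` or `y`. -/
theorem exists_equiv_of_smul_eq_zero {R M : Type*} [CommRing R] [IsDomain R]
    [IsPrincipalIdealRing R] [AddCommGroup M] [Module R M] [Module.Finite R M] {N x y : R}
    (hN : N ≠ 0) (hM : ∀ m : M, N • m = 0)
    (hdvd : ∀ p : R, Irreducible p → ∀ e : ℕ, p ^ e ∣ N →
      IsUnit (p ^ e) ∨ Associated (p ^ e) x ∨ Associated (p ^ e) y) :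
    ∃ a b : ℕ, Nonempty (M ≃ₗ[R] (Fin a → R ⧸ Ideal.span {x}) × (Fin b → R ⧸ Ideal.span {y})) := by
  classical
  obtain ⟨ι, _, p, hp, e, ⟨E⟩⟩ := Module.equiv_directSum_of_isTorsion (R := R) (M := M)
    fun {m} => ⟨⟨N, mem_nonZeroDivisors_of_ne_zero hN⟩, hM m⟩
  let E' := E.trans (DirectSum.linearEquivFunOnFintype R ι fun i => R ⧸ Ideal.span {p i ^ e i})
  have hpe : ∀ i, p i ^ e i ∣ N := by
    intro i
    have h1 : N • (fun _ => Submodule.Quotient.mk 1 : ∀ i, R ⧸ Ideal.span {p i ^ e i}) = 0 := by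
      rw [← E'.apply_symm_apply fun _ => Submodule.Quotient.mk 1, ← map_smul, hM, map_zero]
    have h2 := congrFun h1 i
    rw [Pi.smul_apply, ← Submodule.Quotient.mk_smul, Pi.zero_apply,
      Submodule.Quotient.mk_eq_zero, smul_eq_mul, mul_one, Ideal.mem_span_singleton] at h2
    exact h2
  -- The cyclic summands are grouped by their ideal; `none` collects the trivial ones, where the
  -- prime power is a unit.
  let G : Option (Fin 2) → Ideal R := fun c => c.elim ⊤ ![Ideal.span {x}, Ideal.span {y}]
  have hG : ∀ i, ∃ c, Ideal.span {p i ^ e i} = G c := by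
    intro i
    rcases hdvd _ (hp i) _ (hpe i) with h | h | h
    · exact ⟨none, Ideal.span_singleton_eq_top.2 h⟩
    · exact ⟨some 0, Ideal.span_singleton_eq_span_singleton.2 h⟩
    · exact ⟨some 1, Ideal.span_singleton_eq_span_singleton.2 h⟩
  choose c hc using hG
  let E₁ := E'.trans (LinearEquiv.piCongrLeft' R (fun i => R ⧸ Ideal.span {p i ^ e i})
    (Equiv.sigmaFiberEquiv c).symm)
  let E₂ := E₁.trans (LinearEquiv.piCongrRight (φ := fun z : Σ o, {i // c i = o} =>
      R ⧸ Ideal.span {p ((Equiv.sigmaFiberEquiv c) z) ^ e ((Equiv.sigmaFiberEquiv c) z)})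
      (ψ := fun z => R ⧸ G z.1) fun z =>
    Submodule.quotEquivOfEq _ _ ((hc z.2.1).trans (congrArg G z.2.2)))
  let E₃ := E₂.trans (LinearEquiv.piCurry R fun (o : Option (Fin 2)) (_ : {i // c i = o}) => R ⧸ G o)
  let E₄ := E₃.trans (LinearEquiv.piOptionEquivProd R)
  have : Subsingleton (R ⧸ G none) := Ideal.Quotient.subsingleton_iff.2 rfl
  have : Unique ({i // c i = none} → R ⧸ G none) := ⟨⟨0⟩, fun _ => Subsingleton.elim _ _⟩
  let E₅ := (E₄.trans LinearEquiv.uniqueProd).trans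
    (LinearEquiv.piFinTwo R fun j => ({i // c i = some j} → R ⧸ G (some j)))
  exact ⟨_, _, ⟨E₅.trans ((LinearEquiv.funCongrLeft R _ (Fintype.equivFin _).symm).prodCongr
    (LinearEquiv.funCongrLeft R _ (Fintype.equivFin _).symm))⟩⟩

/-- The Chinese remainder theorem in `R`-linear form. -/
theorem nonempty_quotient_mul_equiv {R : Type*} [CommRing R] {x y : R} (h : IsCoprime x y) :
    Nonempty ((R ⧸ Ideal.span {x * y}) ≃ₗ[R] (R ⧸ Ideal.span {x}) × (R ⧸ Ideal.span {y})) := by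
  let φ : R →ₗ[R] (R ⧸ Ideal.span {x}) × (R ⧸ Ideal.span {y}) :=
    (Submodule.mkQ _).prod (Submodule.mkQ _)
  have hker : LinearMap.ker φ = Ideal.span {x * y} := by
    ext z
    simp only [φ, LinearMap.ker_prod, Submodule.ker_mkQ, Submodule.mem_inf,
      Ideal.mem_span_singleton]
    exact ⟨fun hz => h.mul_dvd hz.1 hz.2, fun hz => ⟨dvd_of_mul_right_dvd hz,
      dvd_of_mul_left_dvd hz⟩⟩
  have hsurj : Function.Surjective φ := by
    rintro ⟨a, b⟩
    obtain ⟨a, rfl⟩ := Submodule.Quotient.mk_surjective _ a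
    obtain ⟨b, rfl⟩ := Submodule.Quotient.mk_surjective _ b
    obtain ⟨u, v, huv⟩ := h
    refine ⟨b * (u * x) + a * (v * y), Prod.ext ?_ ?_⟩
    · change Submodule.Quotient.mk _ = Submodule.Quotient.mk _
      rw [Submodule.Quotient.eq, Ideal.mem_span_singleton]
      exact ⟨(b - a) * u, by linear_combination a * huv⟩
    · change Submodule.Quotient.mk _ = Submodule.Quotient.mk _
      rw [Submodule.Quotient.eq, Ideal.mem_span_singleton]
      exact ⟨(a - b) * v, by linear_combination b * huv⟩
  exact ⟨(Submodule.quotEquivOfEq _ _ hker.symm).trans (φ.quotKerEquivOfSurjective hsurj)⟩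

end ModuleClassification

/-! ### Building the modules described by shapes. -/

section Shapes

variable {F : Type*} [Field F] [NumberField F]

theorem principal_eq_span {x : F} {r : 𝓞 F} (hr : (r : F) = x) : principal x = Ideal.span {r} := by
  ext y
  rw [principal, Submodule.mem_comap, Submodule.mem_span_singleton, Ideal.mem_span_singleton]
  constructor
  · rintro ⟨c, hc⟩
    refine ⟨c, FaithfulSMul.algebraMap_injective (𝓞 F) F ?_⟩
    rw [mul_comm, map_mul]
    rw [Algebra.smul_def, ← hr] at hc
    exact hc.symm
  · rintro ⟨c, rfl⟩
    refine ⟨c, ?_⟩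
    rw [Algebra.smul_def, ← hr, mul_comm r c]
    exact (map_mul (algebraMap (𝓞 F) F) _ _).symm

variable {N M : Type*} [AddCommGroup N] [Module (𝓞 F) N] [AddCommGroup M] [Module (𝓞 F) M]

theorem nonempty_equiv_shape_nil [Subsingleton N] :
    Nonempty (N ≃ₗ[𝓞 F] Shape.Mod ([] : Shape F)) :=
  have : Unique N := ⟨⟨0⟩, fun _ => Subsingleton.elim _ _⟩
  have : Unique (Shape.Mod ([] : Shape F)) := ⟨⟨0⟩, fun _ => funext fun i => i.elim0⟩
  ⟨LinearEquiv.ofSubsingleton _ _⟩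

theorem nonempty_equiv_shape_cons {J : Ideal (𝓞 F)} {x : F} {k m : ℕ} {l : Shape F}
    (hJ : principal (x ^ k) = J) (hN : Nonempty (N ≃ₗ[𝓞 F] Shape.Mod l)) :
    Nonempty (((Fin m → 𝓞 F ⧸ J) × N) ≃ₗ[𝓞 F] Shape.Mod ((x, k, m) :: l)) := by
  subst hJ
  obtain ⟨E⟩ := hN
  exact ⟨((LinearEquiv.refl _ _).prodCongr E).trans
    (Fin.consLinearEquiv (𝓞 F) fun i : Fin (l.length + 1) =>
      Fin (((x, k, m) :: l).get i).2.2 →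
        𝓞 F ⧸ principal ((((x, k, m) :: l).get i).1 ^ (((x, k, m) :: l).get i).2.1))⟩

theorem nonempty_equiv_shape_cons_one {J : Ideal (𝓞 F)} {x : F} {k : ℕ} {l : Shape F}
    (hJ : principal (x ^ k) = J) (hN : Nonempty (N ≃ₗ[𝓞 F] Shape.Mod l)) :
    Nonempty (((𝓞 F ⧸ J) × N) ≃ₗ[𝓞 F] Shape.Mod ((x, k, 1) :: l)) := by
  obtain ⟨E⟩ := nonempty_equiv_shape_cons (m := 1) hJ hN
  exact ⟨((LinearEquiv.funUnique (Fin 1) (𝓞 F) (𝓞 F ⧸ J)).symm.prodCongr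
    (LinearEquiv.refl _ _)).trans E⟩

end Shapes

/-! ### Norms and the primes above 2. -/

section NormTwo

variable {F : Type*} [Field F] [NumberField F] {d : ℤ} {s : F} {σ : F ≃ₐ[ℚ] F}

/-- For d < 0 the norm a² - db² is nonnegative, so factorizations can be tested by multiplying
natural numbers. -/
theorem exists_natCast_norm (hd : d < 0) (hF : Module.finrank ℚ F = 2) (hs : s ^ 2 = (d : F))
    (hσ : σ s = -s) (x : 𝓞 F) : ∃ K : ℕ, (x : F) * σ x = K := by
  have hI := (isInt_coe x).mul ((isInt_coe x).map σ)
  obtain ⟨a, b, hab⟩ := exists_coords hd hF hs hσ (x : F)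
  have hn : (x : F) * σ x = ((a ^ 2 - d * b ^ 2 : ℚ) : F) := by
    rw [hab]
    push_cast
    rw [← hs]
    simp only [map_add, map_mul, map_ratCast, hσ]
    ring
  rw [hn] at hI ⊢
  obtain ⟨k, hk⟩ := exists_int_of_isInt_ratCast hI
  have hk0 : 0 ≤ k := by
    have : (0 : ℚ) ≤ k := by
      rw [← hk]
      have : (d : ℚ) < 0 := by exact_mod_cast hd
      nlinarith [sq_nonneg a, sq_nonneg b]
    exact_mod_cast this
  lift k to ℕ using hk0
  exact ⟨k, by rw [hk]; simp⟩

theorem isUnit_of_norm_eq_one {x : 𝓞 F} (hx : (x : F) * σ x = 1) : IsUnit x := by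
  obtain ⟨y, hy⟩ := (isInt_coe x).map σ
  refine IsUnit.of_mul_eq_one y (FaithfulSMul.algebraMap_injective (𝓞 F) F ?_)
  rw [map_mul, map_one, ← hx, ← hy]

theorem norm_mul (x y : 𝓞 F) :
    ((x * y : 𝓞 F) : F) * σ ((x * y : 𝓞 F) : F) = ((x : F) * σ x) * ((y : F) * σ y) := by
  rw [show ((x * y : 𝓞 F) : F) = x * y from map_mul (algebraMap (𝓞 F) F) x y, map_mul]
  ring

theorem norm_of_isUnit (hd : d < 0) (hF : Module.finrank ℚ F = 2) (hs : s ^ 2 = (d : F))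
    (hσ : σ s = -s) {x : 𝓞 F} (hx : IsUnit x) : (x : F) * σ x = 1 := by
  obtain ⟨y, hxy⟩ := hx.exists_right_inv
  obtain ⟨k, hk⟩ := exists_natCast_norm hd hF hs hσ x
  obtain ⟨j, hj⟩ := exists_natCast_norm hd hF hs hσ y
  have h1 := norm_mul (σ := σ) x y
  rw [hxy, hk, hj, show ((1 : 𝓞 F) : F) = 1 from map_one (algebraMap (𝓞 F) F), map_one,
    mul_one] at h1
  have h2 : 1 = k * j := by exact_mod_cast h1
  rw [hk, Nat.eq_one_of_mul_eq_one_right h2.symm, Nat.cast_one]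

theorem prime_of_norm_eq_two [IsPrincipalIdealRing (𝓞 F)] (hd : d < 0)
    (hF : Module.finrank ℚ F = 2) (hs : s ^ 2 = (d : F)) (hσ : σ s = -s) {x : 𝓞 F}
    (hx : (x : F) * σ x = 2) : Prime x := by
  rw [← irreducible_iff_prime, irreducible_iff]
  refine ⟨fun hu => ?_, fun a b hab => ?_⟩
  · rw [norm_of_isUnit hd hF hs hσ hu] at hx
    exact absurd hx (by norm_num)
  · obtain ⟨k, hk⟩ := exists_natCast_norm hd hF hs hσ a
    obtain ⟨j, hj⟩ := exists_natCast_norm hd hF hs hσ b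
    rw [hab, norm_mul, hk, hj] at hx
    have h2 : k * j = 2 := by exact_mod_cast hx
    rcases (Nat.dvd_prime Nat.prime_two).1 (Dvd.intro _ h2) with rfl | rfl
    · exact Or.inl (isUnit_of_norm_eq_one (hk.trans Nat.cast_one))
    · obtain rfl : j = 1 := by omega
      exact Or.inr (isUnit_of_norm_eq_one (hj.trans Nat.cast_one))

theorem coe_two : ((2 : 𝓞 F) : F) = 2 := map_ofNat (algebraMap (𝓞 F) F) 2

/-- In the fields of class number one other than `ℚ(√-1)`, `ℚ(√-2)` and `ℚ(√-7)`, the prime `2`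
is inert. -/
theorem prime_two [IsPrincipalIdealRing (𝓞 F)] (hd : d < 0) (hsq : Squarefree d)
    (hF : Module.finrank ℚ F = 2) (hs : s ^ 2 = (d : F)) (hσ : σ s = -s) (h1 : d ≠ -1)
    (h2 : d ≠ -2) (h7 : d ≠ -7) : Prime (2 : 𝓞 F) := by
  have h4 : ((2 : 𝓞 F) : F) * σ (2 : 𝓞 F) = 4 := by rw [coe_two, map_ofNat]; norm_num
  rw [← irreducible_iff_prime, irreducible_iff]
  refine ⟨fun hu => ?_, fun a b hab => ?_⟩
  · rw [norm_of_isUnit hd hF hs hσ hu] at h4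
    exact absurd h4 (by norm_num)
  · obtain ⟨k, hk⟩ := exists_natCast_norm hd hF hs hσ a
    obtain ⟨j, hj⟩ := exists_natCast_norm hd hF hs hσ b
    rw [hab, norm_mul, hk, hj] at h4
    have hkj : k * j = 4 := by exact_mod_cast h4
    -- A proper factorization of 2 would have both factors of norm 2.
    have hk2 : k ≠ 2 := by
      rintro rfl
      exact norm_ne_two hd hsq hF hs hσ h1 h2 h7 (isInt_coe a) (by simpa using hk)
    have hk4 : k ≤ 4 := Nat.le_of_dvd (by norm_num) (Dvd.intro _ hkj)
    interval_cases k
    · omega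
    · exact Or.inl (isUnit_of_norm_eq_one (hk.trans Nat.cast_one))
    · omega
    · omega
    · obtain rfl : j = 1 := by omega
      exact Or.inr (isUnit_of_norm_eq_one (hj.trans Nat.cast_one))

end NormTwo

/-! ### Prime powers dividing 2 in the inert, ramified and split cases. -/

section PrimePowers

variable {R : Type*} [CommRing R] [IsDomain R] {p q : R}

theorem pow_dvd_prime_cases (hq : Prime q) {e : ℕ} (h : p ^ e ∣ q) :
    IsUnit (p ^ e) ∨ Associated (p ^ e) q :=
  hq.irreducible.dvd_iff.1 h |>.imp id Associated.symm

theorem pow_dvd_sq_cases (hq : Prime q) {e : ℕ} (h : p ^ e ∣ q ^ 2) :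
    IsUnit (p ^ e) ∨ Associated (p ^ e) q ∨ Associated (p ^ e) (q ^ 2) := by
  obtain ⟨i, hi, hpi⟩ := (dvd_prime_pow hq 2).1 h
  interval_cases i
  · left
    rw [pow_zero] at hpi
    exact associated_one_iff_isUnit.1 hpi
  · right; left
    rwa [pow_one] at hpi
  · exact Or.inr (Or.inr hpi)

theorem pow_dvd_mul_cases [IsPrincipalIdealRing R] {q' : R} (hp : Irreducible p) (hq : Prime q)
    (hq' : Prime q') (hcop : IsCoprime q q') {e : ℕ} (h : p ^ e ∣ q * q') :
    IsUnit (p ^ e) ∨ Associated (p ^ e) q ∨ Associated (p ^ e) q' := by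
  have aux : ∀ {x y : R}, Prime x → Prime y → IsCoprime x y → p ∣ x → p ^ e ∣ x * y →
      IsUnit (p ^ e) ∨ Associated (p ^ e) x := by
    intro x y hx hy hxy hpx hpe
    have hpe' : p ^ e ∣ x := by
      refine IsCoprime.dvd_of_dvd_mul_right (IsCoprime.pow_left ?_) hpe
      exact hxy.of_isCoprime_of_dvd_left hpx
    exact pow_dvd_prime_cases hx hpe'
  rcases e with _ | e
  · exact Or.inl (by simp)
  · rcases hp.prime.dvd_or_dvd ((dvd_pow_self p e.succ_ne_zero).trans h) with h1 | h1
    · exact (aux hq hq' hcop h1 h).imp id Or.inl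
    · exact (aux hq' hq hcop.symm h1 (mul_comm q q' ▸ h)).imp id Or.inr

end PrimePowers

/-! ### The discriminant form and conjugate torsion. -/

section Duality

variable {F V : Type*} [Field F] [NumberField F] [AddCommGroup V] [Module F V]
  {σ : F ≃ₐ[ℚ] F} [Module (𝓞 F) V] [IsScalarTower (𝓞 F) F V]
  {d : ℤ} {s : F} {h : V →ₗ[F] V →ₛₗ[(σ : F →+* F)] F} {n : ℕ} {L I : Submodule (𝓞 F) V}

/-- The discriminant form embeds the `π'`-torsion of `A_L` into the dual of `A_L / π`,
where `π` and `π'` are conjugate up to sign. -/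
theorem IsHermitianLattice.card_torsion_le [IsPrincipalIdealRing (𝓞 F)]
    (hL : IsHermitianLattice d s h n L) (hc : IsConj d s σ) {π π' : 𝓞 F} (hπ : π ≠ 0)
    (hππ : σ (π' : F) = -π) [Finite (DiscGroup d s h L →ₗ[𝓞 F] 𝓞 F ⧸ Ideal.span {π})] :
    Nat.card {a : DiscGroup d s h L // π' • a = 0} ≤
      Nat.card (DiscGroup d s h L →ₗ[𝓞 F] 𝓞 F ⧸ Ideal.span {π}) := by
  have hinj := FaithfulSMul.algebraMap_injective (𝓞 F) F
  have hd0 := hc.invDiff_ne_zero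
  have hπ0 : (π : F) ≠ 0 := fun H => hπ (hinj (H.trans (map_zero _).symm))
  -- The pairing with π'v ∈ L is divided by ∂; conjugate linearity turns the factor π' into σ(π') =
  -- -π.
  have hψ : ∀ v : dualLattice d s h L, (π' : F) • (v : V) ∈ L →
      ∃ ψ : dualLattice d s h L →ₗ[𝓞 F] 𝓞 F, ∀ x : dualLattice d s h L,
        invDiff d s * (ψ x : F) = -π * h x v := by
    intro v hv
    obtain ⟨ψ, hψ⟩ := exists_lift_of_isInt
      ((((invDiff d s)⁻¹ • h.flip ((π' : F) • (v : V))).restrictScalars (𝓞 F)) ∘ₗ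
        (dualLattice d s h L).subtype) (fun x => by
          obtain ⟨y, hy⟩ := x.2 _ hv
          refine ⟨y, ?_⟩
          change (y : F) = (invDiff d s)⁻¹ * h x ((π' : F) • (v : V))
          rw [hy, inv_mul_cancel_left₀ hd0])
    refine ⟨ψ, fun x => ?_⟩
    rw [hψ]
    change _ * ((invDiff d s)⁻¹ * h x ((π' : F) • (v : V))) = _
    rw [mul_inv_cancel_left₀ hd0, form_smul_right, hππ]
  have hrep : ∀ a : {a : DiscGroup d s h L // π' • a = 0},
      ∃ v : dualLattice d s h L, Submodule.Quotient.mk v = a.1 ∧ (π' : F) • (v : V) ∈ L := by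
    rintro ⟨a, ha⟩
    obtain ⟨v, rfl⟩ := Submodule.Quotient.mk_surjective _ a
    refine ⟨v, rfl, ?_⟩
    rw [← Submodule.Quotient.mk_smul, Submodule.Quotient.mk_eq_zero] at ha
    rw [coe_smul_eq]
    exact ha
  choose v hva hvL using hrep
  choose ψ hψ using fun a => hψ (v a) (hvL a)
  have hker : ∀ a, L.submoduleOf (dualLattice d s h L) ≤
      LinearMap.ker ((Ideal.span {π}).mkQ ∘ₗ ψ a) := by
    intro a x hx
    rw [LinearMap.mem_ker, LinearMap.comp_apply, Submodule.mkQ_apply,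
      Submodule.Quotient.mk_eq_zero, Ideal.mem_span_singleton]
    obtain ⟨y, hy⟩ := hL.swap hc ((v a).2 x hx)
    refine ⟨-y, hinj (mul_left_cancel₀ hd0 ?_)⟩
    refine (hψ a x).trans ?_
    rw [hy, map_mul, map_neg]
    ring
  refine Nat.card_le_card_of_injective (fun a => Submodule.liftQ _ _ (hker a)) fun a b hab => ?_
  -- Equality modulo π means that v a - v b pairs into ∂𝓞 with all of L^∨, so biduality applies.
  have hmem : (v a : V) - v b ∈ L := by
    refine hL.mem_of_bidual hc fun x hx => ?_
    have h1 := congrArg (fun φ => φ (Submodule.Quotient.mk ⟨x, hx⟩)) hab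
    change (Submodule.Quotient.mk (ψ a ⟨x, hx⟩) : 𝓞 F ⧸ Ideal.span {π}) =
      Submodule.Quotient.mk (ψ b ⟨x, hx⟩) at h1
    rw [Submodule.Quotient.eq, Ideal.mem_span_singleton] at h1
    obtain ⟨y, hy⟩ := h1
    refine ⟨-y, mul_left_cancel₀ hπ0 ?_⟩
    have h2 := congrArg (algebraMap (𝓞 F) F) hy
    rw [map_sub, map_mul] at h2
    change (ψ a ⟨x, hx⟩ : F) - ψ b ⟨x, hx⟩ = (π : F) * y at h2
    have ha := hψ a ⟨x, hx⟩
    have hb := hψ b ⟨x, hx⟩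
    rw [map_sub, show ((-y : 𝓞 F) : F) = -(y : F) from map_neg (algebraMap (𝓞 F) F) y]
    linear_combination ha - hb - invDiff d s * h2
  refine Subtype.ext ?_
  rw [← hva a, ← hva b]
  exact (Submodule.Quotient.eq _).2 hmem

end Duality

/-! ### Counting homomorphisms and torsion. -/

section Counting

variable {R : Type*} [CommRing R] [IsDomain R] {x y : R}

theorem linearMap_eq_zero_of_isCoprime {M N : Type*} [AddCommGroup M] [Module R M]
    [AddCommGroup N] [Module R N] (hxy : IsCoprime x y) (hM : ∀ m : M, x • m = 0)
    (hN : ∀ m : N, y • m = 0) (φ : M →ₗ[R] N) : φ = 0 := by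
  ext m
  obtain ⟨a, b, hab⟩ := hxy
  rw [← one_smul R (φ m), ← hab, add_smul, mul_smul, mul_smul, hN, ← map_smul, hM, map_zero]
  simp

theorem smul_quotient_eq_zero (m : R ⧸ Ideal.span {x}) : x • m = 0 := by
  obtain ⟨r, rfl⟩ := Submodule.Quotient.mk_surjective _ m
  rw [← Submodule.Quotient.mk_smul, Submodule.Quotient.mk_eq_zero, smul_eq_mul,
    Ideal.mem_span_singleton]
  exact Dvd.intro _ rfl

/-- The module `(R / x) ^ p × (R / y) ^ q × R / N`. -/
abbrev TwoPrimeModule (x y N : R) (p q : ℕ) : Type _ :=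
  ((Fin p → R ⧸ Ideal.span {x}) × (Fin q → R ⧸ Ideal.span {y})) × (R ⧸ Ideal.span {N})

/-- A homomorphism to R/x kills the R/y factors by coprimality, so it is determined by the images of
p + 1 generators. -/
theorem card_hom_le (hxy : IsCoprime x y) (N : R) (p q : ℕ) [Finite (R ⧸ Ideal.span {x})] :
    Nat.card (TwoPrimeModule x y N p q →ₗ[R] R ⧸ Ideal.span {x}) ≤
      Nat.card (R ⧸ Ideal.span {x}) ^ (p + 1) := by
  let Φ : (TwoPrimeModule x y N p q →ₗ[R] R ⧸ Ideal.span {x}) →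
      (Fin p → R ⧸ Ideal.span {x}) × (R ⧸ Ideal.span {x}) := fun φ =>
    (fun i => φ ((Pi.single i (Submodule.Quotient.mk 1), 0), 0), φ ((0, 0), Submodule.Quotient.mk 1))
  have hΦ : Function.Injective Φ := by
    intro φ φ' hφ
    rw [Prod.ext_iff] at hφ
    obtain ⟨h1, h2⟩ := hφ
    apply LinearMap.prod_ext
    · apply LinearMap.prod_ext
      · apply LinearMap.pi_ext'
        intro i
        apply Submodule.linearMap_qext
        apply LinearMap.ext_ring
        exact congrFun h1 i
      · rw [linearMap_eq_zero_of_isCoprime hxy.symm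
          (fun m => funext fun i => smul_quotient_eq_zero (m i)) smul_quotient_eq_zero
          ((φ ∘ₗ LinearMap.inl R _ _) ∘ₗ LinearMap.inr R _ _),
          linearMap_eq_zero_of_isCoprime hxy.symm
          (fun m => funext fun i => smul_quotient_eq_zero (m i)) smul_quotient_eq_zero
          ((φ' ∘ₗ LinearMap.inl R _ _) ∘ₗ LinearMap.inr R _ _)]
    · apply Submodule.linearMap_qext
      apply LinearMap.ext_ring
      exact h2
  refine (Nat.card_le_card_of_injective Φ hΦ).trans ?_
  rw [Nat.card_prod, Nat.card_fun, pow_succ]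
  simp

/-- The q factors R/y are killed by y, and multiplication by z = N/y embeds one more copy of R/y
into R/N. -/
theorem le_card_torsion {N z : R} (hz : z ≠ 0) (hN : N = z * y) (p q : ℕ)
    [Finite (TwoPrimeModule x y N p q)] :
    Nat.card (R ⧸ Ideal.span {y}) ^ (q + 1) ≤
      Nat.card {a : TwoPrimeModule x y N p q // y • a = 0} := by
  let μ : (R ⧸ Ideal.span {y}) →ₗ[R] R ⧸ Ideal.span {N} :=
    Submodule.mapQ _ _ (LinearMap.lsmul R R z) fun r hr => by
      rw [Ideal.mem_span_singleton] at hr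
      rw [Submodule.mem_comap, Ideal.mem_span_singleton, hN]
      exact mul_dvd_mul_left z hr
  have hμ : Function.Injective μ := by
    rw [injective_iff_map_eq_zero]
    intro a ha
    obtain ⟨r, rfl⟩ := Submodule.Quotient.mk_surjective _ a
    change Submodule.Quotient.mk (z * r) = 0 at ha
    rw [Submodule.Quotient.mk_eq_zero, Ideal.mem_span_singleton, hN] at ha
    rw [Submodule.Quotient.mk_eq_zero, Ideal.mem_span_singleton]
    exact (mul_dvd_mul_iff_left hz).1 ha
  let Φ : (Fin q → R ⧸ Ideal.span {y}) × (R ⧸ Ideal.span {y}) →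
      {a : TwoPrimeModule x y N p q // y • a = 0} := fun f =>
    ⟨((0, f.1), μ f.2), by
      refine Prod.ext (Prod.ext ?_ ?_) ?_
      · exact smul_zero y
      · exact funext fun i => smul_quotient_eq_zero (f.1 i)
      · change y • μ f.2 = 0
        rw [← map_smul, smul_quotient_eq_zero, map_zero]⟩
  have hΦ : Function.Injective Φ := by
    rintro ⟨f, a⟩ ⟨f', a'⟩ hf
    have h1 := congrArg Subtype.val hf
    simp only [Φ, Prod.mk.injEq, true_and] at h1
    exact Prod.ext h1.1 (hμ h1.2)
  refine le_trans (le_of_eq ?_) (Nat.card_le_card_of_injective Φ hΦ)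
  rw [Nat.card_prod, Nat.card_fun, pow_succ]
  simp

end Counting

/-! ### Structure of irregular cusps and vacuity of the higher indices. -/

section Structure

variable {F V : Type*} [Field F] [NumberField F] [AddCommGroup V] [Module F V]
  {σ : F ≃ₐ[ℚ] F} [Module (𝓞 F) V] [IsScalarTower (𝓞 F) F V]
  {d : ℤ} {s : F} {h : V →ₗ[F] V →ₛₗ[(σ : F →+* F)] F} {n : ℕ} {L I : Submodule (𝓞 F) V}

theorem isConj_of_sqrt (hd : d < 0) (hF : Module.finrank ℚ F = 2) (hs : s ^ 2 = (d : F))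
    (hσ : σ s = -s) : IsConj d s σ :=
  ⟨conj_conj hd hF hs hσ, invDiff_ne_zero hd hs, conj_invDiff d hσ,
    fun _ => exists_ratCast_of_conj_eq hd hF hs hσ⟩

/-- A cusp with `U₁ ≠ U₋₁` has `div(I) = 2∂` up to a unit, and `A_L` is the product of `𝓞 / 4`
and a module killed by `2`. -/
theorem IsIrregular2.structure [IsPrincipalIdealRing (𝓞 F)]
    (hL : IsHermitianLattice d s h n L) (hc : IsConj d s σ) (hI : IsCusp h L I)
    (hirr : IsIrregular2 h I (discKernel d s h L)) {δ : F} (hδ : IsDiv h L I δ) :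
    (∃ u : (𝓞 F)ˣ, δ = ((u : 𝓞 F) : F) * (2 * invDiff d s)) ∧
    Module.Finite (𝓞 F) (DiscGroup d s h L) ∧
    ∃ C : Submodule (𝓞 F) (DiscGroup d s h L), (∀ x ∈ C, (2 : 𝓞 F) • x = 0) ∧
      Nonempty (DiscGroup d s h L ≃ₗ[𝓞 F] C × (𝓞 F ⧸ Ideal.span {(4 : 𝓞 F)})) := by
  obtain ⟨e, he, hdiv⟩ := hδ
  obtain ⟨g, hgU, hgW, hgΓ⟩ := exists_of_arithU_ne (le_withScalar _ _) hirr
  obtain ⟨k, γ, hγ, hgk⟩ := exists_zpow_smul_of_mem_withScalar (neg_ne_zero.2 one_ne_zero) hgW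
  -- An even power would put g itself in Γ.
  have hk : (-1 : F) ^ k = -1 := by
    rcases Int.even_or_odd k with hk | hk
    · refine absurd ?_ hgΓ
      convert hγ
      ext v
      rw [hgk, hk.neg_one_zpow, one_smul]
    · exact hk.neg_one_zpow
  rw [hk] at hgk
  obtain ⟨τ, m, r, hm, hr, hδm, hτm, hmr, hint, key⟩ :=
    hL.transvection_constraints hc hI he hdiv hgU hγ isInt_one.neg hgk
  have h2 : (1 : F) - -1 = 2 := by norm_num
  rw [h2] at key hmr
  rw [map_ofNat] at hmr
  obtain ⟨j, rfl⟩ := exists_half_of_not_int hτm hr hmr fun H => hgΓ (hint H)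
  obtain ⟨u, rfl⟩ := exists_unit_of_half hm hr hτm hmr
  exact ⟨⟨u, by rw [hδm]; ring⟩, hL.exists_splitting hc hI he key⟩

/-- For `d = -1`, adjoining `√-1` to `⟨Γ, -id⟩` does not enlarge `U(I)_ℚ ∩ ⟨Γ, -id⟩`. -/
theorem arithU_neg_one_eq_of_sq [IsPrincipalIdealRing (𝓞 F)]
    (hL : IsHermitianLattice d s h n L) (hc : IsConj d s σ) (hI : IsCusp h L I)
    (hs : s ^ 2 = -1) (hσ : σ s = -s) :
    arithU h I (withScalar (discKernel d s h L) (-1)) =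
      arithU h I (withScalar (discKernel d s h L) s) := by
  have hs0 : s ≠ 0 := by
    rintro rfl
    norm_num at hs
  have hsI : IsInt s := isInt_iff.2 (IsIntegral.of_pow (n := 2) two_pos (by
    rw [hs]; exact isIntegral_one.neg))
  by_contra hne
  -- The square of the homothety s is -id.
  have hle : withScalar (discKernel d s h L) (-1) ≤ withScalar (discKernel d s h L) s := by
    refine (Subgroup.closure_le _).2 ?_
    rintro g (hg | hg)
    · exact le_withScalar _ _ hg
    · have hS : (LinearEquiv.smulOfNeZero F V s hs0) ∈ withScalar (discKernel d s h L) s :=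
        Subgroup.subset_closure (Or.inr fun v => rfl)
      have hgS : g = LinearEquiv.smulOfNeZero F V s hs0 * LinearEquiv.smulOfNeZero F V s hs0 := by
        ext v
        rw [hg v, LinearEquiv.mul_apply]
        change _ = s • s • v
        rw [smul_smul, ← sq, hs]
      exact hgS ▸ mul_mem hS hS
  obtain ⟨δ, e, he, hdiv⟩ := hI.exists_isDiv hL
  obtain ⟨g, hgU, hgW, hgΓ⟩ := exists_of_arithU_ne hle hne
  obtain ⟨k, γ, hγ, hgk⟩ := exists_zpow_smul_of_mem_withScalar hs0 hgW
  have hγ' := le_withScalar (discKernel d s h L) (-1) hγ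
  have hs2 : ∀ i : ℤ, s ^ (2 * i) = (-1) ^ i := fun i => by
    rw [zpow_mul]
    exact congrArg (· ^ i) (by exact_mod_cast hs)
  have hpow : ∀ i : ℤ, ∀ g γ : V ≃ₗ[F] V, γ ∈ withScalar (discKernel d s h L) (-1) →
      (∀ v, g v = (-1 : F) ^ i • γ v) → g ∈ withScalar (discKernel d s h L) (-1) := by
    intro i g γ hγ hg
    rcases Int.even_or_odd i with hi | hi
    · convert hγ
      ext v
      rw [hg, hi.neg_one_zpow, one_smul]
    · have hS : LinearEquiv.neg F ∈ withScalar (discKernel d s h L) (-1) :=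
        Subgroup.subset_closure (Or.inr fun v => by simp)
      convert mul_mem hS hγ
      ext v
      rw [hg, hi.neg_one_zpow, LinearEquiv.mul_apply]
      simp
  obtain ⟨i, hi | hi⟩ := Int.even_or_odd' k
  · exact hgΓ (hpow i g γ hγ' fun v => by rw [hgk, hi, hs2])
  -- For odd k the scalar c is a primitive fourth root of unity with σ(c) = -c, so m divides 1 + c
  -- and τ is an integer.
  · have hcc : s ^ k = s ∨ s ^ k = -s := by
      rw [hi, zpow_add₀ hs0, hs2, zpow_one]
      rcases Int.even_or_odd i with h | h <;> simp [h.neg_one_zpow]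
    have hk2 : (s ^ k) ^ 2 = -1 := by rcases hcc with h | h <;> simp [h, hs]
    have hσk : σ (s ^ k) = -s ^ k := by rcases hcc with h | h <;> simp [h, hσ]
    have hkI : IsInt (s ^ k) := by
      rcases hcc with h | h
      · rwa [h]
      · rw [h]
        exact hsI.neg
    obtain ⟨τ, m, r, hm, hr, -, hτm, hmr, hint, -⟩ :=
      hL.transvection_constraints hc hI he hdiv hgU hγ hkI hgk
    rw [map_sub, map_one, hσk, sub_neg_eq_add] at hmr
    exact hgΓ (le_withScalar _ _ (hint (int_of_sq_eq_neg_one hm hr hkI hτm hk2 hmr)))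

/-- For a primitive cube root of unity `ω`, adjoining `ω` to the discriminant kernel `Γ` does not
enlarge `U(I)_ℚ ∩ Γ`. -/
theorem arithU_eq_of_cube_root [IsPrincipalIdealRing (𝓞 F)]
    (hL : IsHermitianLattice d s h n L) (hc : IsConj d s σ) (hI : IsCusp h L I) {ω : F}
    (hω : ω ^ 2 + ω + 1 = 0) (hσ : σ ω = ω ^ 2) :
    arithU h I (discKernel d s h L) = arithU h I (withScalar (discKernel d s h L) ω) := by
  have hω0 : ω ≠ 0 := by
    rintro rfl
    norm_num at hω
  have hω3 : ω ^ 3 = 1 := by linear_combination (ω - 1) * hω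
  have hωI : IsInt ω := isInt_iff.2 (IsIntegral.of_pow (n := 3) three_pos (by
    rw [hω3]; exact isIntegral_one))
  by_contra hne
  obtain ⟨δ, e, he, hdiv⟩ := hI.exists_isDiv hL
  obtain ⟨g, hgU, hgW, hgΓ⟩ := exists_of_arithU_ne (le_withScalar _ _) hne
  obtain ⟨k, γ, hγ, hgk⟩ := exists_zpow_smul_of_mem_withScalar hω0 hgW
  have hcc : ω ^ k = 1 ∨ ω ^ k = ω ∨ ω ^ k = ω ^ 2 := by
    have h3 : ω ^ k = ω ^ (k % 3) := by
      conv_lhs => rw [← Int.mul_ediv_add_emod k 3, zpow_add₀ hω0, zpow_mul]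
      rw [show ω ^ (3 : ℤ) = 1 by exact_mod_cast hω3, one_zpow, one_mul]
    rw [h3]
    rcases (by omega : k % 3 = 0 ∨ k % 3 = 1 ∨ k % 3 = 2) with h | h | h <;> rw [h]
    · simp
    · simp
    · exact Or.inr (Or.inr (by norm_cast))
  rcases hcc with h1 | hcc
  · refine hgΓ ?_
    convert hγ
    ext v
    rw [hgk, h1, one_smul]
  · generalize ω ^ k = c at hgk hcc
    have hcI : IsInt c := by
      rcases hcc with h | h <;> rw [h]
      · exact hωI
      · rw [sq]
        exact hωI.mul hωI
    have hσc : IsInt (σ c) := hcI.map σ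
    -- The divisibility involves σ(1 - c), so the cube root fed to `int_of_cube_root` is σ(c).
    have hroot : (σ c) ^ 2 + σ c + 1 = 0 := by
      rcases hcc with h | h <;> rw [h]
      · rw [hσ]
        linear_combination ω * hω3 + hω
      · rw [map_pow, hσ]
        linear_combination (ω ^ 5 + ω ^ 2 + ω) * hω3 + hω
    obtain ⟨τ, m, r, hm, hr, -, hτm, hmr, hint, -⟩ :=
      hL.transvection_constraints hc hI he hdiv hgU hγ hcI hgk
    rw [map_sub, map_one] at hmr
    exact hgΓ (hint (int_of_cube_root hm hr hσc hτm hroot hmr))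

end Structure

/-! ### The module C × 𝓞/4 for 2 inert, ramified and split. -/

section Tables

variable {F A : Type*} [Field F] [NumberField F] [AddCommGroup A] [Module (𝓞 F) A]
  {C : Submodule (𝓞 F) A}

theorem nonempty_equiv_inert [IsPrincipalIdealRing (𝓞 F)] [Module.Finite (𝓞 F) A]
    (hC : ∀ x ∈ C, (2 : 𝓞 F) • x = 0)
    (E : A ≃ₗ[𝓞 F] C × (𝓞 F ⧸ Ideal.span {(4 : 𝓞 F)})) (hp : Prime (2 : 𝓞 F)) :
    ∃ a : ℕ, Nonempty (A ≃ₗ[𝓞 F] Shape.Mod ([(2, 1, a), (2, 2, 1)] : Shape F)) := by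
  -- Only one prime power is nontrivial here; y = 1 makes the second family of factors zero.
  obtain ⟨a, b, ⟨E'⟩⟩ := exists_equiv_of_smul_eq_zero (R := 𝓞 F) (M := C) (N := 2) (x := 2) (y := 1)
    two_ne_zero (fun m => Subtype.ext (hC m m.2))
    fun p _ e hpe => (pow_dvd_prime_cases hp hpe).imp id Or.inl
  have : Subsingleton (𝓞 F ⧸ Ideal.span {(1 : 𝓞 F)}) :=
    Ideal.Quotient.subsingleton_iff.2 Ideal.span_singleton_one
  have : Unique (Fin b → 𝓞 F ⧸ Ideal.span {(1 : 𝓞 F)}) := ⟨⟨0⟩, fun _ => Subsingleton.elim _ _⟩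
  obtain ⟨E₂⟩ := nonempty_equiv_shape_cons (m := a) (x := (2 : F)) (k := 1)
    (J := Ideal.span {(2 : 𝓞 F)}) (principal_eq_span (by rw [coe_two, pow_one]))
    (nonempty_equiv_shape_cons_one (x := (2 : F)) (k := 2) (J := Ideal.span {(4 : 𝓞 F)})
      (principal_eq_span ((map_ofNat (algebraMap (𝓞 F) F) 4).trans (by norm_num)))
      (nonempty_equiv_shape_nil (N := PUnit)))
  exact ⟨a, ⟨E.trans <| ((E'.trans LinearEquiv.prodUnique).prodCongr
    LinearEquiv.prodUnique.symm).trans E₂⟩⟩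

/-- Up to units 2 = η² and 4 = η⁴: C has only factors 𝓞/η and 𝓞/η², and the split summand is 𝓞/η⁴.
-/
theorem nonempty_equiv_ramified [IsPrincipalIdealRing (𝓞 F)] [Module.Finite (𝓞 F) A]
    (hC : ∀ x ∈ C, (2 : 𝓞 F) • x = 0)
    (E : A ≃ₗ[𝓞 F] C × (𝓞 F ⧸ Ideal.span {(4 : 𝓞 F)})) {η : 𝓞 F} (hp : Prime η)
    (hη : Associated (η ^ 2) 2) :
    ∃ a b : ℕ, Nonempty (A ≃ₗ[𝓞 F]
      Shape.Mod ([((η : F), 1, a), ((η : F), 2, b), ((η : F), 4, 1)] : Shape F)) := by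
  obtain ⟨a, b, ⟨E'⟩⟩ := exists_equiv_of_smul_eq_zero (R := 𝓞 F) (M := C) (N := 2) (x := η)
    (y := η ^ 2) two_ne_zero (fun m => Subtype.ext (hC m m.2))
    fun p _ e hpe => pow_dvd_sq_cases hp (hpe.trans hη.symm.dvd)
  have h4 : Ideal.span {η ^ 4} = Ideal.span {(4 : 𝓞 F)} := by
    rw [Ideal.span_singleton_eq_span_singleton]
    rw [show η ^ 4 = η ^ 2 * η ^ 2 by ring, show (4 : 𝓞 F) = 2 * 2 by norm_num]
    exact hη.mul_mul hη
  obtain ⟨E₂⟩ := nonempty_equiv_shape_cons (m := a) (x := (η : F)) (k := 1)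
    (J := Ideal.span {η}) (principal_eq_span (pow_one _).symm)
    (nonempty_equiv_shape_cons (m := b) (x := (η : F)) (k := 2)
      (J := Ideal.span {η ^ 2}) (principal_eq_span (map_pow (algebraMap (𝓞 F) F) η 2))
      (nonempty_equiv_shape_cons_one (x := (η : F)) (k := 4) (J := Ideal.span {(4 : 𝓞 F)})
        (h4 ▸ principal_eq_span (map_pow (algebraMap (𝓞 F) F) η 4))
        (nonempty_equiv_shape_nil (N := PUnit))))
  exact ⟨a, b, ⟨E.trans <| (E'.prodCongr LinearEquiv.prodUnique.symm).trans <|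
    (LinearEquiv.prodAssoc _ _ _ _).trans E₂⟩⟩

/-- Since 4 = π²π'² with coprime factors, 𝓞/4 contributes one factor 𝓞/π² and one 𝓞/π'². -/
theorem nonempty_equiv_split {π π' : 𝓞 F} (hcop : IsCoprime π π') (h2 : π * π' = -2) (a b : ℕ)
    (E : A ≃ₗ[𝓞 F] TwoPrimeModule π π' 4 a b) :
    Nonempty (A ≃ₗ[𝓞 F] Shape.Mod
      ([((π : F), 1, a), ((π' : F), 1, b), ((π : F), 2, 1), ((π' : F), 2, 1)] : Shape F)) := by
  obtain ⟨E₁⟩ := nonempty_quotient_mul_equiv (hcop.pow (m := 2) (n := 2))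
  have h4 : Ideal.span {(4 : 𝓞 F)} = Ideal.span {π ^ 2 * π' ^ 2} := by
    congr 2
    linear_combination (2 - π * π') * h2
  obtain ⟨E₂⟩ := nonempty_equiv_shape_cons (m := a) (x := (π : F)) (k := 1)
    (J := Ideal.span {π}) (principal_eq_span (pow_one _).symm)
    (nonempty_equiv_shape_cons (m := b) (x := (π' : F)) (k := 1)
      (J := Ideal.span {π'}) (principal_eq_span (pow_one _).symm)
      (nonempty_equiv_shape_cons_one (x := (π : F)) (k := 2) (J := Ideal.span {π ^ 2})
        (principal_eq_span (map_pow (algebraMap (𝓞 F) F) π 2))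
        (nonempty_equiv_shape_cons_one (x := (π' : F)) (k := 2) (J := Ideal.span {π' ^ 2})
          (principal_eq_span (map_pow (algebraMap (𝓞 F) F) π' 2))
          (nonempty_equiv_shape_nil (N := PUnit)))))
  exact ⟨E.trans <| ((LinearEquiv.refl _ _).prodCongr ((Submodule.quotEquivOfEq _ _ h4).trans
    (E₁.trans ((LinearEquiv.refl _ _).prodCongr LinearEquiv.prodUnique.symm)))).trans <|
    (LinearEquiv.prodAssoc _ _ _ _).trans E₂⟩

end Tables

/-! ### Equality of exponents in the split case. -/

section Exponents

variable {F V : Type*} [Field F] [NumberField F] [AddCommGroup V] [Module F V]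
  {σ : F ≃ₐ[ℚ] F} [Module (𝓞 F) V] [IsScalarTower (𝓞 F) F V]
  {d : ℤ} {s : F} {h : V →ₗ[F] V →ₛₗ[(σ : F →+* F)] F} {n : ℕ} {L I : Submodule (𝓞 F) V}

theorem finite_quotient_span {x : 𝓞 F} (hx : x ≠ 0) : Finite (𝓞 F ⧸ Ideal.span {x}) :=
  Ideal.finiteQuotientOfFreeOfNeBot _ (by simpa [Ideal.span_singleton_eq_bot] using hx)

/-- The two ideal norms multiply to N(-2) = 4 and neither is 1. -/
theorem card_quotient_eq_two (hF : Module.finrank ℚ F = 2) {π π' : 𝓞 F} (hπ : Prime π)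
    (hπ' : Prime π') (h2 : π * π' = -2) : Nat.card (𝓞 F ⧸ Ideal.span {π}) = 2 := by
  have hmul : Ideal.absNorm (Ideal.span {π}) * Ideal.absNorm (Ideal.span {π'}) = 4 := by
    rw [← map_mul, Ideal.span_singleton_mul_span_singleton, h2, Ideal.absNorm_span_singleton,
      show (-2 : 𝓞 F) = algebraMap ℤ (𝓞 F) (-2) by simp, Algebra.norm_algebraMap,
      NumberField.RingOfIntegers.rank, hF]
    norm_num
  have hne : ∀ {x : 𝓞 F}, Prime x → Ideal.absNorm (Ideal.span {x}) ≠ 1 := fun hx H =>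
    hx.not_isUnit (Ideal.span_singleton_eq_top.1 (Ideal.absNorm_eq_one_iff.1 H))
  change Ideal.absNorm (Ideal.span {π}) = 2
  have h1 := hne hπ
  have h1' := hne hπ'
  have hle : Ideal.absNorm (Ideal.span {π}) ≤ 4 := Nat.le_of_dvd (by norm_num) (Dvd.intro _ hmul)
  generalize Ideal.absNorm (Ideal.span {π}) = j at *
  interval_cases j <;> omega

/-- The π'-torsion has at least 2^(q+1) elements, while Hom(A_L, 𝓞/π) has at most 2^(p+1); duality
compares them. The extra 1 on each side comes from 𝓞/4. -/
theorem IsHermitianLattice.exponent_le [IsPrincipalIdealRing (𝓞 F)]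
    (hF : Module.finrank ℚ F = 2) (hL : IsHermitianLattice d s h n L) (hc : IsConj d s σ)
    {π π' : 𝓞 F} (hπ : Prime π) (hπ' : Prime π') (h2 : π * π' = -2) (hcop : IsCoprime π π')
    (hππ : σ (π' : F) = -π) {p q : ℕ}
    (E : DiscGroup d s h L ≃ₗ[𝓞 F] TwoPrimeModule π π' 4 p q) : q ≤ p := by
  have := finite_quotient_span hπ.ne_zero
  have := finite_quotient_span hπ'.ne_zero
  have := finite_quotient_span (F := F) (x := 4) (by norm_num)
  have : Finite (DiscGroup d s h L) := Finite.of_equiv _ E.symm.toEquiv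
  have : Finite (DiscGroup d s h L →ₗ[𝓞 F] 𝓞 F ⧸ Ideal.span {π}) := DFunLike.finite _
  have h1 := le_card_torsion (x := π) (y := π') (N := 4) (z := -(2 * π))
    (neg_ne_zero.2 (mul_ne_zero two_ne_zero hπ.ne_zero)) (by linear_combination 2 * h2) p q
  have h3 := hL.card_torsion_le hc hπ.ne_zero hππ
  have h4 := card_hom_le hcop (4 : 𝓞 F) p q
  have e1 : Nat.card {a : DiscGroup d s h L // π' • a = 0} =
      Nat.card {a : TwoPrimeModule π π' 4 p q // π' • a = 0} :=
    Nat.card_congr (E.toEquiv.subtypeEquiv fun a => by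
      change _ ↔ π' • E a = 0
      rw [← map_smul, LinearEquiv.map_eq_zero_iff])
  have e2 : Nat.card (DiscGroup d s h L →ₗ[𝓞 F] 𝓞 F ⧸ Ideal.span {π}) =
      Nat.card (TwoPrimeModule π π' 4 p q →ₗ[𝓞 F] 𝓞 F ⧸ Ideal.span {π}) :=
    Nat.card_congr (LinearEquiv.congrLeft _ (𝓞 F) E).toEquiv
  have h5 := h1.trans (e1 ▸ h3.trans (e2 ▸ h4))
  rw [card_quotient_eq_two hF hπ hπ' h2,
    card_quotient_eq_two hF hπ' hπ (by rw [mul_comm, h2])] at h5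
  have := (Nat.pow_le_pow_iff_right one_lt_two).1 h5
  omega

end Exponents

/-! ### The row of the table for d = -1, -2 and -7. -/

section Rows

variable {F V : Type*} [Field F] [NumberField F] [AddCommGroup V] [Module F V]
  {σ : F ≃ₐ[ℚ] F} [Module (𝓞 F) V] [IsScalarTower (𝓞 F) F V]
  {d : ℤ} {s : F} {h : V →ₗ[F] V →ₛₗ[(σ : F →+* F)] F} {n : ℕ} {L I : Submodule (𝓞 F) V}

theorem inTable_of_mem {T : List (Row F)} {r : Row F} {δ c : F} {A : Type*} [AddCommGroup A]
    [Module (𝓞 F) A] (hr : r ∈ T) (w : (𝓞 F)ˣ) (hc : c = ((w : 𝓞 F) : F) * r.1)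
    (hδ : ∃ u : (𝓞 F)ˣ, δ = ((u : 𝓞 F) : F) * c)
    {l : Shape F} (hl : l ∈ r.2) (E : Nonempty (A ≃ₗ[𝓞 F] Shape.Mod l)) : InTable T δ A := by
  obtain ⟨u, rfl⟩ := hδ
  refine ⟨r, hr, ⟨u * w, ?_⟩, l, hl, E⟩
  rw [hc, ← mul_assoc, Units.val_mul]
  exact congrArg (· * r.1) (map_mul (algebraMap (𝓞 F) F) _ _).symm

theorem coe_unit_one : (((1 : (𝓞 F)ˣ) : 𝓞 F) : F) = 1 := map_one (algebraMap (𝓞 F) F)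

theorem coe_unit_neg (u : (𝓞 F)ˣ) : (((-u : (𝓞 F)ˣ) : 𝓞 F) : F) = -((u : 𝓞 F) : F) :=
  map_neg (algebraMap (𝓞 F) F) _

theorem inTable_gauss [IsPrincipalIdealRing (𝓞 F)] (hF : Module.finrank ℚ F = 2)
    (hs : s ^ 2 = ((-1 : ℤ) : F)) (hσ : σ s = -s) (hL : IsHermitianLattice (-1) s h n L)
    (hI : IsCusp h L I) (hirr : IsIrregular2 h I (discKernel (-1) s h L)) {δ : F}
    (hδ : IsDiv h L I δ) : InTable (tableGauss2 s) δ (DiscGroup (-1) s h L) := by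
  obtain ⟨hu, hfin, C, hC, ⟨E⟩⟩ := hirr.structure hL
    (isConj_of_sqrt (by norm_num) hF hs hσ) hI hδ
  have hs1 : s ^ 2 = -1 := by rw [hs]; norm_num
  have hs0 := sqrt_ne_zero (by norm_num) hs
  obtain ⟨t, ht⟩ : IsInt s := isInt_iff.2 (IsIntegral.of_pow (n := 2) two_pos (by
    rw [hs1]; exact isIntegral_one.neg))
  have hinj := FaithfulSMul.algebraMap_injective (𝓞 F) F
  have htt : t ^ 2 = -1 := hinj (by rw [map_pow, map_neg, map_one, ← hs1, ← ht])
  have hη : ((1 + t : 𝓞 F) : F) = 1 + s := by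
    rw [← ht]
    exact (map_add (algebraMap (𝓞 F) F) 1 t).trans (by rw [map_one])
  let u : (𝓞 F)ˣ := Units.mkOfMulEqOne t (-t) (by linear_combination -htt)
  have hp : Prime (1 + t) := by
    refine prime_of_norm_eq_two (σ := σ) (by norm_num) hF hs hσ ?_
    rw [hη, map_add, map_one, hσ]
    linear_combination -hs1
  obtain ⟨a, b, E'⟩ := nonempty_equiv_ramified hC E hp
    -- The relation used is (1 + s)² = 2s.
    (Associated.symm ⟨u, by
      change 2 * t = _
      linear_combination -htt⟩)
  rw [hη] at E'
  -- Here 2∂ = 1/s = -s is a unit, so div(I) = 1, with c = 4.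
  refine inTable_of_mem (List.Mem.head _) (-u) ?_ hu
    ⟨a, b, [(1 + s, 4, 1)], List.mem_append_left _ (List.mem_map.2 ⟨4, by simp, rfl⟩), rfl⟩ E'
  rw [coe_unit_neg, show ((u : 𝓞 F) : F) = s from ht, invDiff, if_neg (by norm_num)]
  field_simp
  linear_combination hs1

theorem inTable_two [IsPrincipalIdealRing (𝓞 F)] (hF : Module.finrank ℚ F = 2)
    (hs : s ^ 2 = ((-2 : ℤ) : F)) (hσ : σ s = -s) (hL : IsHermitianLattice (-2) s h n L)
    (hI : IsCusp h L I) (hirr : IsIrregular2 h I (discKernel (-2) s h L)) {δ : F}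
    (hδ : IsDiv h L I δ) : InTable (tableTwo s) δ (DiscGroup (-2) s h L) := by
  obtain ⟨hu, hfin, C, hC, ⟨E⟩⟩ := hirr.structure hL
    (isConj_of_sqrt (by norm_num) hF hs hσ) hI hδ
  have hs0 := sqrt_ne_zero (by norm_num) hs
  obtain ⟨t, ht⟩ : IsInt s := isInt_iff.2 (IsIntegral.of_pow (n := 2) two_pos (by
    rw [hs]; exact isInt_iff.1 (isInt_intCast _)))
  have hinj := FaithfulSMul.algebraMap_injective (𝓞 F) F
  have htt : t ^ 2 = -2 := hinj (by
    rw [map_pow, map_neg, map_ofNat, show algebraMap (𝓞 F) F t = s from ht, hs]; norm_num)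
  have hp : Prime t := by
    refine prime_of_norm_eq_two (σ := σ) (by norm_num) hF hs hσ ?_
    rw [ht, hσ]
    push_cast at hs
    linear_combination -hs
  obtain ⟨a, b, E'⟩ := nonempty_equiv_ramified hC E hp
    (by rw [htt]; exact (Associated.refl _).neg_left)
  rw [ht] at E'
  -- Here 2∂ = 1/s, and again c = 4.
  refine inTable_of_mem (List.Mem.head _) 1 ?_ hu
    ⟨a, b, [(s, 4, 1)], List.mem_append_left _ (List.mem_map.2 ⟨4, by simp, rfl⟩), rfl⟩ E'
  rw [coe_unit_one, invDiff, if_neg (by norm_num)]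
  field_simp

theorem inTable_seven [IsPrincipalIdealRing (𝓞 F)] (hF : Module.finrank ℚ F = 2)
    (hs : s ^ 2 = ((-7 : ℤ) : F)) (hσ : σ s = -s) (hL : IsHermitianLattice (-7) s h n L)
    (hI : IsCusp h L I) (hirr : IsIrregular2 h I (discKernel (-7) s h L)) {δ : F}
    (hδ : IsDiv h L I δ) : InTable (tableSeven s) δ (DiscGroup (-7) s h L) := by
  have hc := isConj_of_sqrt (by norm_num) hF hs hσ
  obtain ⟨hu, hfin, C, hC, ⟨E⟩⟩ := hirr.structure hL hc hI hδ
  have hs0 := sqrt_ne_zero (by norm_num) hs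
  have hs7 : s ^ 2 = -7 := by rw [hs]; norm_num
  have hinj := FaithfulSMul.algebraMap_injective (𝓞 F) F
  obtain ⟨π', hπ'⟩ : IsInt ((-1 + s) / 2) := by
    refine isInt_iff.2 ⟨Polynomial.X ^ 2 + Polynomial.X + 2, by monicity!, ?_⟩
    simp only [Polynomial.eval₂_add, Polynomial.eval₂_pow, Polynomial.eval₂_X,
      Polynomial.eval₂_ofNat]
    linear_combination hs7 / 4
  obtain ⟨π, hπ⟩ : IsInt ((1 + s) / 2) := ⟨1 + π', by
    refine (map_add (algebraMap (𝓞 F) F) 1 π').trans ?_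
    rw [map_one, show algebraMap (𝓞 F) F π' = _ from hπ']
    ring⟩
  have hσπ : σ (π : F) = -π' := by
    rw [hπ, hπ', map_div₀, map_add, map_one, map_ofNat, hσ]
    ring
  have hσπ' : σ (π' : F) = -π := by
    rw [hπ, hπ', map_div₀, map_add, map_neg, map_one, map_ofNat, hσ]
    ring
  have hmul : (π : F) * π' = -2 := by
    rw [hπ, hπ']
    linear_combination hs7 / 4
  have h2 : π * π' = -2 := hinj (by rw [map_mul, map_neg, map_ofNat, ← hmul])
  -- The difference π - π' is 1.
  have hcop : IsCoprime π π' := ⟨1, -1, hinj (by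
    simp only [map_add, map_mul, map_neg, map_one]
    rw [show algebraMap (𝓞 F) F π = _ from hπ, show algebraMap (𝓞 F) F π' = _ from hπ']
    ring)⟩
  have hp : Prime π := prime_of_norm_eq_two (σ := σ) (by norm_num) hF hs hσ
    (by rw [hσπ]; linear_combination -hmul)
  have hp' : Prime π' := prime_of_norm_eq_two (σ := σ) (by norm_num) hF hs hσ
    (by rw [hσπ']; linear_combination -hmul)
  obtain ⟨p, q, ⟨E'⟩⟩ := exists_equiv_of_smul_eq_zero (R := 𝓞 F) (M := C) (N := 2) (x := π)
    (y := π') two_ne_zero (fun m => Subtype.ext (hC m m.2))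
    fun x hx e hxe => pow_dvd_mul_cases hx hp hp' hcop (h2 ▸ (dvd_neg.2 hxe))
  let E₁ : DiscGroup (-7) s h L ≃ₗ[𝓞 F] TwoPrimeModule π π' 4 p q :=
    E.trans (E'.prodCongr (LinearEquiv.refl _ _))
  -- Exchanging the roles of the conjugate primes yields the reverse inequality of exponents.
  let E₂ : DiscGroup (-7) s h L ≃ₗ[𝓞 F] TwoPrimeModule π' π 4 q p :=
    E₁.trans ((LinearEquiv.prodComm _ _ _).prodCongr (LinearEquiv.refl _ _))
  have hle := hL.exponent_le hF hc hp hp' h2 hcop hσπ' E₁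
  have hle' := hL.exponent_le hF hc hp' hp (by rw [mul_comm, h2]) hcop.symm hσπ E₂
  obtain rfl := le_antisymm hle hle'
  have E₃ := nonempty_equiv_split hcop h2 q q E₁
  rw [hπ, hπ'] at E₃
  -- As η₁η₂ = -2, 2∂ = -η₁η₂/s; equal exponents give the entry with shifts (0, 0).
  refine inTable_of_mem (.tail _ (.tail _ (.tail _ (.tail _ (.head _))))) (-1) ?_ hu
    ⟨q, q, q, (0, 0, [((1 + s) / 2, 2, 1), ((-1 + s) / 2, 2, 1)]), ?_, by simp, by simp, rfl⟩ E₃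
  · rw [coe_unit_neg, coe_unit_one, ← hπ, ← hπ', hmul, invDiff, if_pos (by norm_num)]
    ring
  · simp

end Rows

end UnitaryCusp

/-! ### Assembly of all cases. -/

open UnitaryCusp in
theorem mainTheorem3 (d : ℤ) (hd : d < 0) (hsq : Squarefree d)
    {F : Type*} [Field F] [NumberField F] (hF : Module.finrank ℚ F = 2)
    (hcl : NumberField.classNumber F = 1)
    (s : F) (hs : s ^ 2 = (d : F)) (σ : F ≃ₐ[ℚ] F) (hσ : σ s = -s)
    {V : Type*} [AddCommGroup V] [Module F V] [Module (𝓞 F) V] [IsScalarTower (𝓞 F) F V]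
    (h : V →ₗ[F] V →ₛₗ[(σ : F →+* F)] F) (n : ℕ) (L : Submodule (𝓞 F) V)
    (hL : IsHermitianLattice d s h n L)
    (I : Submodule (𝓞 F) V) (hI : IsCusp h L I) :
    (∃ δ : F, IsDiv h L I δ) ∧
    ∀ δ : F, IsDiv h L I δ →
      (d = -1 → Gauss.IsIrregular2 h I (discKernel d s h L) s →
        InTable (tableGauss2 s) δ (DiscGroup d s h L)) ∧
      (d = -1 → (Gauss.IsSpecial2 h I (discKernel d s h L) s ∨
          Gauss.IsIrregular4 h I (discKernel d s h L) s) →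
        InTable (tableGauss4 s) δ (DiscGroup d s h L)) ∧
      (d = -2 → IsIrregular2 h I (discKernel d s h L) →
        InTable (tableTwo s) δ (DiscGroup d s h L)) ∧
      (d = -3 → (Eisenstein.IsIrregular2 h I (discKernel d s h L) s ∨
          Eisenstein.IsSpecial2 h I (discKernel d s h L) s) →
        InTable (tableEisenstein2 s) δ (DiscGroup d s h L)) ∧
      (d = -3 → (Eisenstein.IsIrregular3 h I (discKernel d s h L) s ∨
          Eisenstein.IsSpecial3 h I (discKernel d s h L) s) →
        InTable (tableEisenstein3 s) δ (DiscGroup d s h L)) ∧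
      (d = -3 → Eisenstein.IsIrregular6 h I (discKernel d s h L) s →
        InTable (tableEisenstein6 s) δ (DiscGroup d s h L)) ∧
      (d = -7 → IsIrregular2 h I (discKernel d s h L) →
        InTable (tableSeven s) δ (DiscGroup d s h L)) ∧
      (d ≠ -1 → d ≠ -2 → d ≠ -3 → d ≠ -7 → IsIrregular2 h I (discKernel d s h L) →
        InTable (tableOther s) δ (DiscGroup d s h L)) := by
  have := (NumberField.classNumber_eq_one_iff (K := F)).1 hcl
  have hc := isConj_of_sqrt hd hF hs hσ
  have hs0 := sqrt_ne_zero hd hs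
  -- The case d = -3 shares the inert argument with the remaining fields; an inert 2 forces d ≡ 1
  -- mod 4, so 2∂ = 2/s.
  have inert : d ≠ -1 → d ≠ -2 → d ≠ -7 → IsIrregular2 h I (discKernel d s h L) →
      ∀ δ : F, IsDiv h L I δ →
        (∃ u : (𝓞 F)ˣ, δ = ((u : 𝓞 F) : F) * (2 * invDiff d s)) ∧
        2 * invDiff d s = (((1 : (𝓞 F)ˣ) : 𝓞 F) : F) * (2 / s) ∧
        ∃ a : ℕ, Nonempty (DiscGroup d s h L ≃ₗ[𝓞 F]
          Shape.Mod ([(2, 1, a), (2, 2, 1)] : Shape F)) := by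
    intro h1 h2 h7 hirr δ hδ
    obtain ⟨hu, hfin, C, hC, ⟨E⟩⟩ := hirr.structure hL hc hI hδ
    have hp := prime_two hd hsq hF hs hσ h1 h2 h7
    refine ⟨hu, ?_, nonempty_equiv_inert hC E hp⟩
    rw [coe_unit_one, invDiff, if_pos (emod_four_of_prime_two hsq hs hσ hp), one_mul,
      div_eq_mul_inv]
  have hω : d = -3 → arithU h I (discKernel d s h L) =
      arithU h I (withScalar (discKernel d s h L) (Eisenstein.omega s)) := by
    rintro rfl
    push_cast at hs
    refine arithU_eq_of_cube_root hL hc hI ?_ ?_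
    · rw [Eisenstein.omega]
      linear_combination hs / 4
    · rw [Eisenstein.omega, map_div₀, map_add, map_neg, map_one, map_ofNat, hσ]
      linear_combination -hs / 4
  refine ⟨hI.exists_isDiv hL, fun δ hδ => ⟨?_, ?_, ?_, ?_, ?_, ?_, ?_, ?_⟩⟩
  · rintro rfl hirr
    exact inTable_gauss hF hs hσ hL hI hirr.1 hδ
  · rintro rfl hirr
    -- Both hypotheses include U₋₁ ≠ U_i, which is impossible.
    have heq := arithU_neg_one_eq_of_sq hL hc hI (by rw [hs]; norm_num) hσ
    rcases hirr with hirr | hirr <;> exact absurd heq hirr.2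
  · rintro rfl hirr
    exact inTable_two hF hs hσ hL hI hirr hδ
  · intro h3 hirr
    have hirr' : IsIrregular2 h I (discKernel d s h L) := hirr.elim (fun H => H.1) fun H => H.2.2
    obtain ⟨hu, hdiv, a, E⟩ := inert (by omega) (by omega) (by omega) hirr' δ hδ
    exact inTable_of_mem (.tail _ (.tail _ (.head _))) 1 hdiv hu
      ⟨a, [(2, 2, 1)], by simp, rfl⟩ E
  · intro h3 hirr
    -- Index 3 requires U₁ ≠ U_ω, which never happens; the same contradiction settles index 6.
    rcases hirr with hirr | hirr <;> exact absurd (hω h3) hirr.2.2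
  · intro h3 hirr
    exact absurd (hω h3) hirr.2
  · rintro rfl hirr
    exact inTable_seven hF hs hσ hL hI hirr hδ
  · intro h1 h2 h3 h7 hirr
    obtain ⟨hu, hdiv, a, E⟩ := inert h1 h2 h7 hirr δ hδ
    exact inTable_of_mem (.tail _ (.head _)) 1 hdiv hu ⟨a, [(2, 2, 1)], by simp, rfl⟩ E
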